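/- Let $\nu\in\mathbb N$, $k\ge 1$, and let $\mathbb Z^\nu$ carry the metric $d(x,y)=\max_j|x_j-y_j|$. For finite $\Lambda\subset\mathbb Z^\nu$ let $\mathcal A_\Lambda=\bigotimes_{x\in\Lambda}M_k(\mathbb C)$, let $\mathcal A=\overline{\bigcup_\Lambda\mathcal A_\Lambda}^{\|\cdot\|}$ be the quasi-local algebra (with $\mathcal A_{\Lambda_0}\subset\mathcal A_\Lambda$ for $\Lambda_0\subset\Lambda$ via $a\mapsto a\otimes 1$), and let $\tau_x$ ($x\in\mathbb Z^\nu$) be the translation automorphisms of $\mathcal A$. Let $F:[0,\infty)\to(0,\infty)$ be an $F$-function: non-increasing, with $\sup_x\sum_y F(d(x,y))<\infty$, and with some $C_F>0$ such that $\sum_z F(d(x,z))F(d(z,y))\le C_F F(d(x,y))$ for all $x,y$. Let $(\Omega,\mathcal F,\mathbb P)$ be a probability space with an ergodic action $(\vartheta_x)_{x\in\mathbb Z^\nu}$ of $\mathbb Z^\nu$ by measurable, measure-preserving maps. Let $\mathfrak h$ be an ergodic interaction, that is, a map assigning to $\omega\in\Omega$ and finite $Z\subset\mathbb Z^\nu$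 an element $\mathfrak h(\omega,Z)\in\mathcal A$ such that, for every $Z$: almost surely $\mathfrak h(\omega,Z)=\mathfrak h(\omega,Z)^*\in\mathcal A_Z$; the function $\omega\mapsto\varphi(\mathfrak h(\omega,Z))$ is measurable for every $\varphi\in\mathcal A^*$; and $\tau_x(\mathfrak h(\omega,Z))=\mathfrak h(\vartheta_x\omega,Z+x)$ almost surely for every $x$. Put $$\mathcal N^{\mathfrak h}_F(\omega)=\sup_{x,y\in\mathbb Z^\nu}\ \sum_{Z\ni x,y}\|\mathfrak h(\omega,Z)\|\,F(d(x,y))^{-1}\in[0,\infty],$$ $H^\Lambda_\omega=\sum_{Z\subset\Lambda}\mathfrak h(\omega,Z)$ and $\alpha^\Lambda_{t;\omega}(a)=e^{itH^\Lambda_\omega}\,a\,e^{-itH^\Lambda_\omega}$. Suppose that $\mathbb P[\mathcal N^{\mathfrak h}_F<\infty]>0$. Then: 1. $\mathcal N^{\mathfrak h}_F$ is almost surely equal to a (finite) constant. 2. The thermodynamic limit of the dynamics exists almost surely and is covariant: there are $*$-automorphisms $\alpha_{t;\omega}$ of $\mathcal A$ ($t\in\mathbb R$, $\omega\in\Omega$),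 with $\omega\mapsto\varphi(\alpha_{t;\omega}(a))$ measurable for all $t\in\mathbb R$, $a\in\mathcal A$ and $\varphi\in\mathcal A^*$, such that for almost every $\omega$: for every sequence $\Lambda_1\subset\Lambda_2\subset\cdots$ of finite sets with $\bigcup_n\Lambda_n=\mathbb Z^\nu$, every $t\in\mathbb R$ and every $a\in\mathcal A$, $$\lim_{n\to\infty}\|\alpha^{\Lambda_n}_{t;\omega}(a)-\alpha_{t;\omega}(a)\|=0,$$ and $$\alpha_{t;\omega}=\tau_{-x}\circ\alpha_{t;\vartheta_x\omega}\circ\tau_x\qquad\text{for all }x\in\mathbb Z^\nu,\ t\in\mathbb R.$$ -/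

import Mathlib

open MeasureTheory Filter Topology
open scoped NNReal ENNReal

noncomputable section

namespace SpinSystem

/-! ### Configurations on the lattice `ℤ^ν` -/

/-- The lattice `ℤ^ν` of sites. Its Mathlib distance `dist` is the `ℓ^∞` metric `max_j |x_j - y_j|`. -/
abbrev Site (ν : ℕ) : Type := Fin ν → ℤ

/-- Configurations of `k`-level spins on the whole lattice. -/
abbrev Config (ν k : ℕ) : Type := Site ν → Fin k

/-- Configurations of `k`-level spins in a finite volume `Λ`. -/
abbrev LocalConfig {ν : ℕ} (k : ℕ) (Λ : Finset (Site ν)) : Type := Λ → Fin k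

/-- The restriction of a configuration to a finite volume. -/
def restrict {ν k : ℕ} (Λ : Finset (Site ν)) (σ : Config ν k) : LocalConfig k Λ :=
  fun x => σ x

/-- Overwrite the spins of `σ` inside `Λ` by those of `s`. -/
def glue {ν k : ℕ} {Λ : Finset (Site ν)} (s : LocalConfig k Λ) (σ : Config ν k) :
    Config ν k :=
  fun x => if h : x ∈ Λ then s ⟨x, h⟩ else σ x

@[simp] lemma restrict_glue {ν k : ℕ} {Λ : Finset (Site ν)} (s : LocalConfig k Λ)
    (σ : Config ν k) : restrict Λ (glue s σ) = s := by
  funext x; simp [restrict, glue]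

@[simp] lemma glue_restrict {ν k : ℕ} {Λ : Finset (Site ν)} (σ : Config ν k) :
    glue (restrict Λ σ) σ = σ := by
  funext x; by_cases h : x ∈ Λ <;> simp [restrict, glue]

@[simp] lemma glue_glue {ν k : ℕ} {Λ : Finset (Site ν)} (s t : LocalConfig k Λ)
    (σ : Config ν k) : glue s (glue t σ) = glue s σ := by
  funext x; by_cases h : x ∈ Λ <;> simp [glue, h]

/-- The involution `(σ, s) ↦ (s on Λ and σ off Λ, σ|_Λ)`. -/
def swapEquiv {ν : ℕ} (k : ℕ) (Λ : Finset (Site ν)) :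
    Config ν k × LocalConfig k Λ ≃ Config ν k × LocalConfig k Λ where
  toFun p := (glue p.2 p.1, restrict Λ p.1)
  invFun p := (glue p.2 p.1, restrict Λ p.1)
  left_inv p := by simp
  right_inv p := by simp

/-! ### The Hilbert space on which the observables are realised

The local algebras `⨂_{x ∈ Λ} M_k(ℂ)` are embedded isometrically, and compatibly with the
inclusions `a ↦ a ⊗ 1`, into the bounded operators on one Hilbert space, so that their union and
its norm completion become a union and a norm closure of subalgebras (see `norm_localEmbed`,
`localEmbed_extendMatrix`, `coe_locAlg`). -/

/-- `ℓ²` of the set of all configurations: the space with orthonormal basis `(δ_σ)_σ`. -/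
abbrev ConfigSpace (ν k : ℕ) : Type := lp (fun _ : Config ν k => ℂ) 2

lemma summable_normSq {ι : Type*} (f : lp (fun _ : ι => ℂ) 2) :
    Summable fun i => ‖f i‖ ^ 2 := by
  have := (lp.memℓp f).summable (by norm_num)
  simpa using this

lemma norm_sq_eq {ι : Type*} (f : lp (fun _ : ι => ℂ) 2) :
    ‖f‖ ^ 2 = ∑' i, ‖f i‖ ^ 2 := by
  have := lp.norm_rpow_eq_tsum (p := 2) (by norm_num) f
  simpa using this

lemma memℓp_two {ι : Type*} {f : ι → ℂ} (hf : Summable fun i => ‖f i‖ ^ 2) :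
    Memℓp f 2 := by
  refine memℓp_gen ?_
  simpa using hf

section Local

variable {ν k : ℕ} {Λ : Finset (Site ν)}

lemma summable_prod (f : ConfigSpace ν k) :
    Summable fun p : Config ν k × LocalConfig k Λ => ‖f p.1‖ ^ 2 := by
  have h := (summable_normSq f).mul_of_nonneg
    (Summable.of_finite (f := fun _ : LocalConfig k Λ => (1 : ℝ)))
    (fun _ => by positivity) (fun _ => by positivity)
  simpa using h

lemma summable_prod_glue (f : ConfigSpace ν k) :
    Summable fun p : Config ν k × LocalConfig k Λ => ‖f (glue p.2 p.1)‖ ^ 2 :=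
  (swapEquiv k Λ).summable_iff.2 (summable_prod f)

lemma tsum_glue (f : ConfigSpace ν k) :
    ∑' σ, ∑ s : LocalConfig k Λ, ‖f (glue s σ)‖ ^ 2
      = Fintype.card (LocalConfig k Λ) * ‖f‖ ^ 2 := by
  have h1 : ∑' p : Config ν k × LocalConfig k Λ, ‖f (glue p.2 p.1)‖ ^ 2
      = ∑' p : Config ν k × LocalConfig k Λ, ‖f p.1‖ ^ 2 :=
    (swapEquiv k Λ).tsum_eq (fun p : Config ν k × LocalConfig k Λ => ‖f p.1‖ ^ 2)
  rw [(summable_prod_glue f).tsum_prod, (summable_prod f).tsum_prod] at h1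
  simp only [tsum_fintype, Finset.sum_const, nsmul_eq_mul, Finset.card_univ] at h1
  rw [h1, tsum_mul_left, norm_sq_eq]

/-- A matrix `m` over the configurations in `Λ` acts on the spins in `Λ` and leaves the others
alone: `(m f)(σ) = ∑_s m(σ|_Λ, s) f(s on Λ, σ off Λ)`. -/
def localFun (m : Matrix (LocalConfig k Λ) (LocalConfig k Λ) ℂ) (f : Config ν k → ℂ) :
    Config ν k → ℂ :=
  fun σ => ∑ s : LocalConfig k Λ, m (restrict Λ σ) s * f (glue s σ)

lemma normSq_localFun_le (m : Matrix (LocalConfig k Λ) (LocalConfig k Λ) ℂ)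
    (f : Config ν k → ℂ) (σ : Config ν k) :
    ‖localFun m f σ‖ ^ 2 ≤
      (∑ s, ∑ t, ‖m s t‖ ^ 2) * ∑ s : LocalConfig k Λ, ‖f (glue s σ)‖ ^ 2 := by
  have h1 : ‖localFun m f σ‖ ≤ ∑ s : LocalConfig k Λ, ‖m (restrict Λ σ) s‖ * ‖f (glue s σ)‖ := by
    refine (norm_sum_le _ _).trans (le_of_eq ?_)
    simp
  have h2 := Finset.sum_mul_sq_le_sq_mul_sq (Finset.univ : Finset (LocalConfig k Λ))
    (fun s => ‖m (restrict Λ σ) s‖) (fun s => ‖f (glue s σ)‖)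
  have h3 : ∑ t, ‖m (restrict Λ σ) t‖ ^ 2 ≤ ∑ s, ∑ t, ‖m s t‖ ^ 2 :=
    Finset.single_le_sum (f := fun s => ∑ t, ‖m s t‖ ^ 2) (fun _ _ => by positivity)
      (Finset.mem_univ (restrict Λ σ))
  calc ‖localFun m f σ‖ ^ 2
      ≤ (∑ s : LocalConfig k Λ, ‖m (restrict Λ σ) s‖ * ‖f (glue s σ)‖) ^ 2 := by gcongr
    _ ≤ _ := h2
    _ ≤ _ := by gcongr

lemma summable_glue (f : ConfigSpace ν k) :
    Summable fun σ => ∑ s : LocalConfig k Λ, ‖f (glue s σ)‖ ^ 2 := by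
  have h := (summable_prod_glue (Λ := Λ) f).prod
  simpa only [tsum_fintype] using h

lemma summable_localFun (m : Matrix (LocalConfig k Λ) (LocalConfig k Λ) ℂ)
    (f : ConfigSpace ν k) : Summable fun σ => ‖localFun m f σ‖ ^ 2 :=
  Summable.of_nonneg_of_le (fun _ => by positivity) (normSq_localFun_le m f)
    ((summable_glue f).mul_left _)

/-- The bounded operator `m ⊗ 1` on `ℓ²` of the configurations. -/
def localOp (m : Matrix (LocalConfig k Λ) (LocalConfig k Λ) ℂ) :
    ConfigSpace ν k →L[ℂ] ConfigSpace ν k :=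
  LinearMap.mkContinuous
    { toFun := fun f => ⟨localFun m f, memℓp_two (summable_localFun m f)⟩
      map_add' := fun f g => by
        ext σ
        simp only [localFun, lp.coeFn_add, Pi.add_apply, mul_add, Finset.sum_add_distrib]
      map_smul' := fun c f => by
        ext σ
        simp only [localFun, lp.coeFn_smul, Pi.smul_apply, smul_eq_mul, RingHom.id_apply,
          Finset.mul_sum]
        exact Finset.sum_congr rfl fun s _ => by ring }
    (Real.sqrt ((∑ s, ∑ t, ‖m s t‖ ^ 2) * Fintype.card (LocalConfig k Λ)))
    (fun f => by
      refine le_of_sq_le_sq ?_ (by positivity)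
      rw [mul_pow, Real.sq_sqrt (by positivity), norm_sq_eq, mul_assoc, ← tsum_glue (Λ := Λ) f,
        ← tsum_mul_left]
      exact Summable.tsum_le_tsum (normSq_localFun_le m f) (summable_localFun m f)
        ((summable_glue f).mul_left _))

lemma localOp_apply (m : Matrix (LocalConfig k Λ) (LocalConfig k Λ) ℂ) (f : ConfigSpace ν k)
    (σ : Config ν k) :
    localOp m f σ = ∑ s : LocalConfig k Λ, m (restrict Λ σ) s * f (glue s σ) := rfl


lemma localOp_mul (m n : Matrix (LocalConfig k Λ) (LocalConfig k Λ) ℂ) :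
    localOp (ν := ν) (m * n) = localOp m * localOp n := by
  ext f σ
  simp only [mul_apply_eq_comp, localOp_apply, restrict_glue, glue_glue,
    Matrix.mul_apply, Finset.sum_mul, Finset.mul_sum]
  rw [Finset.sum_comm]
  exact Finset.sum_congr rfl fun _ _ => Finset.sum_congr rfl fun _ _ => by ring

lemma localOp_one :
    localOp (ν := ν) (1 : Matrix (LocalConfig k Λ) (LocalConfig k Λ) ℂ) = 1 := by
  ext f σ
  simp [localOp_apply, Matrix.one_apply]

lemma summable_inner_glue (m : Matrix (LocalConfig k Λ) (LocalConfig k Λ) ℂ)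
    (f g : ConfigSpace ν k) :
    Summable fun p : Config ν k × LocalConfig k Λ =>
      m (restrict Λ p.1) p.2 * (star (f p.1) * g (glue p.2 p.1)) := by
  have hM : ∀ s t, ‖m s t‖ ≤ ∑ s, ∑ t, ‖m s t‖ := fun s t =>
    (Finset.single_le_sum (f := fun t => ‖m s t‖) (fun _ _ => norm_nonneg _)
      (Finset.mem_univ t)).trans
    (Finset.single_le_sum (f := fun s => ∑ t, ‖m s t‖) (fun _ _ => by positivity)
      (Finset.mem_univ s))
  refine Summable.of_norm_bounded
    (g := fun p => (∑ s, ∑ t, ‖m s t‖) * (‖f p.1‖ ^ 2 + ‖g (glue p.2 p.1)‖ ^ 2))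
    (((summable_prod f).add (summable_prod_glue g)).mul_left _) fun p => ?_
  rw [norm_mul, norm_mul, norm_star]
  have h1 := hM (restrict Λ p.1) p.2
  have h2 : ‖f p.1‖ * ‖g (glue p.2 p.1)‖ ≤ ‖f p.1‖ ^ 2 + ‖g (glue p.2 p.1)‖ ^ 2 := by
    nlinarith [sq_nonneg (‖f p.1‖ - ‖g (glue p.2 p.1)‖), sq_nonneg ‖f p.1‖,
      sq_nonneg ‖g (glue p.2 p.1)‖]
  gcongr

lemma localOp_star (m : Matrix (LocalConfig k Λ) (LocalConfig k Λ) ℂ) :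
    localOp (ν := ν) (star m) = star (localOp m) := by
  rw [ContinuousLinearMap.star_eq_adjoint, ContinuousLinearMap.eq_adjoint_iff]
  intro f g
  rw [lp.inner_eq_tsum, lp.inner_eq_tsum]
  have key : ∑' p : Config ν k × LocalConfig k Λ,
        m p.2 (restrict Λ p.1) * (star (f (glue p.2 p.1)) * g p.1)
      = ∑' p : Config ν k × LocalConfig k Λ,
        m (restrict Λ p.1) p.2 * (star (f p.1) * g (glue p.2 p.1)) := by
    rw [← (swapEquiv k Λ).tsum_eq (fun p : Config ν k × LocalConfig k Λ =>
      m (restrict Λ p.1) p.2 * (star (f p.1) * g (glue p.2 p.1)))]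
    simp [swapEquiv]
  have hs : Summable fun p : Config ν k × LocalConfig k Λ =>
      m p.2 (restrict Λ p.1) * (star (f (glue p.2 p.1)) * g p.1) := by
    have := (swapEquiv k Λ).summable_iff.2 (summable_inner_glue m f g)
    refine this.congr fun p => ?_
    simp [swapEquiv]
  rw [hs.tsum_prod, (summable_inner_glue m f g).tsum_prod] at key
  simp only [tsum_fintype] at key
  refine Eq.trans (tsum_congr fun σ => ?_) (key.trans (tsum_congr fun σ => ?_))
  · simp only [localOp_apply, RCLike.inner_apply, map_sum, map_mul, Finset.mul_sum,
      Matrix.star_apply, RCLike.star_def, RCLike.conj_conj]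
    exact Finset.sum_congr rfl fun s _ => by ring
  · simp only [localOp_apply, RCLike.inner_apply, Finset.sum_mul, RCLike.star_def]
    exact Finset.sum_congr rfl fun s _ => by ring

/-- The embedding `m ↦ m ⊗ 1` of the algebra `⨂_{x ∈ Λ} M_k(ℂ)`, which is the algebra of
matrices over the configurations in `Λ`, into the bounded operators on `ℓ²` of the
configurations of the whole lattice. -/
def localEmbed (ν k : ℕ) (Λ : Finset (Site ν)) :
    Matrix (LocalConfig k Λ) (LocalConfig k Λ) ℂ →⋆ₐ[ℂ]
      (ConfigSpace ν k →L[ℂ] ConfigSpace ν k) where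
  toFun := localOp
  map_one' := localOp_one
  map_mul' := localOp_mul
  map_zero' := by ext f σ; simp [localOp_apply]
  map_add' m n := by
    ext f σ
    simp [localOp_apply, add_mul, Finset.sum_add_distrib]
  commutes' c := by
    ext f σ
    simp [localOp_apply, Algebra.algebraMap_eq_smul_one, Matrix.one_apply]
  map_star' := localOp_star

lemma localEmbed_apply (m : Matrix (LocalConfig k Λ) (LocalConfig k Λ) ℂ) (f : ConfigSpace ν k)
    (σ : Config ν k) :
    localEmbed ν k Λ m f σ = ∑ s : LocalConfig k Λ, m (restrict Λ σ) s * f (glue s σ) := rfl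

lemma localEmbed_injective [NeZero k] : Function.Injective (localEmbed ν k Λ) := by
  classical
  intro m n h
  ext s t
  have h1 := congrArg (fun T : ConfigSpace ν k →L[ℂ] ConfigSpace ν k =>
    T (lp.single 2 (glue t (fun _ => 0)) (1 : ℂ)) (glue s (fun _ => 0))) h
  have aux : ∀ u : LocalConfig k Λ,
      (glue u (fun _ => (0 : Fin k)) : Config ν k) = glue t (fun _ => 0) ↔ u = t := fun u =>
    ⟨fun h => by simpa using congrArg (restrict Λ) h, fun h => by rw [h]⟩
  simpa [localEmbed_apply, lp.single_apply, Pi.single_apply, aux] using h1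

open scoped Matrix.Norms.L2Operator in
/-- The embedding of a local algebra is isometric for the operator norm of matrices. -/
lemma norm_localEmbed [NeZero k] (m : Matrix (LocalConfig k Λ) (LocalConfig k Λ) ℂ) :
    ‖localEmbed ν k Λ m‖ = ‖m‖ :=
  NonUnitalStarAlgHom.norm_map (localEmbed ν k Λ) localEmbed_injective m

/-- The canonical inclusion `a ↦ a ⊗ 1` of the algebra of `Λ₀` into that of `Λ ⊇ Λ₀`. -/
def extendMatrix {Λ₀ : Finset (Site ν)} (h : Λ₀ ⊆ Λ)
    (m : Matrix (LocalConfig k Λ₀) (LocalConfig k Λ₀) ℂ) :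
    Matrix (LocalConfig k Λ) (LocalConfig k Λ) ℂ :=
  fun s t => if ∀ x : Λ, x.1 ∉ Λ₀ → s x = t x then
    m (fun x => s ⟨x, h x.2⟩) (fun x => t ⟨x, h x.2⟩) else 0

lemma localEmbed_extendMatrix {Λ₀ : Finset (Site ν)} (h : Λ₀ ⊆ Λ)
    (m : Matrix (LocalConfig k Λ₀) (LocalConfig k Λ₀) ℂ) :
    localEmbed ν k Λ (extendMatrix h m) = localEmbed ν k Λ₀ m := by
  ext f σ
  rw [localEmbed_apply, localEmbed_apply]
  symm
  refine Finset.sum_of_injOn (fun u => restrict Λ (glue u σ)) ?_ (by simp) ?_ ?_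
  · intro u _ v _ huv
    funext x
    have := congrFun huv ⟨x, h x.2⟩
    simpa [restrict, glue] using this
  · intro t _ ht
    have : ¬ ∀ x : Λ, x.1 ∉ Λ₀ → restrict Λ σ x = t x := by
      intro hx
      refine ht ⟨fun x => t ⟨x, h x.2⟩, by simp, ?_⟩
      funext x
      by_cases hx0 : x.1 ∈ Λ₀
      · simp [restrict, glue, hx0]
      · simpa [restrict, glue, hx0] using hx x hx0
    simp only [extendMatrix, if_neg this, zero_mul]
  · intro u _
    have h1 : ∀ x : Λ, x.1 ∉ Λ₀ → restrict Λ σ x = restrict Λ (glue u σ) x := by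
      intro x hx
      simp [restrict, glue, hx]
    have h2 : (fun x : Λ₀ => restrict Λ (glue u σ) ⟨x, h x.2⟩) = u := by
      funext x
      simp [restrict, glue]
    have h3 : glue (restrict Λ (glue u σ)) σ = glue u σ := by
      funext x
      by_cases hx : x ∈ Λ
      · simp [restrict, glue, hx]
      · have : x ∉ Λ₀ := fun hx' => hx (h hx')
        simp [glue, hx, this]
    simp only [extendMatrix, if_pos h1, h2, h3]
    rfl

end Local

/-! ### Local and quasi-local observables -/

/-- The local algebra `𝒜_Λ` of a finite volume `Λ`. -/
def localAlg (ν k : ℕ) (Λ : Finset (Site ν)) :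
    StarSubalgebra ℂ (ConfigSpace ν k →L[ℂ] ConfigSpace ν k) :=
  (localEmbed ν k Λ).range

lemma localAlg_mono {ν k : ℕ} : Monotone (localAlg ν k) := by
  rintro Λ₀ Λ h _ ⟨m, rfl⟩
  exact ⟨extendMatrix h m, localEmbed_extendMatrix h m⟩

/-- The algebra `𝒜^loc` of all local observables, the union of the local algebras. -/
def locAlg (ν k : ℕ) : StarSubalgebra ℂ (ConfigSpace ν k →L[ℂ] ConfigSpace ν k) :=
  ⨆ Λ, localAlg ν k Λ

lemma coe_locAlg (ν k : ℕ) :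
    (locAlg ν k : Set (ConfigSpace ν k →L[ℂ] ConfigSpace ν k)) = ⋃ Λ, (localAlg ν k Λ : Set _) :=
  StarSubalgebra.coe_iSup_of_directed localAlg_mono.directed_le

lemma mem_locAlg {ν k : ℕ} {a : ConfigSpace ν k →L[ℂ] ConfigSpace ν k} :
    a ∈ locAlg ν k ↔ ∃ Λ, a ∈ localAlg ν k Λ := by
  rw [← SetLike.mem_coe, coe_locAlg, Set.mem_iUnion]
  rfl

/-- The quasi-local algebra as a norm-closed `*`-subalgebra: the norm closure of the union of the
local algebras. -/
def quasiLocalAlg (ν k : ℕ) : StarSubalgebra ℂ (ConfigSpace ν k →L[ℂ] ConfigSpace ν k) :=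
  (locAlg ν k).topologicalClosure

instance (ν k : ℕ) :
    IsClosed (quasiLocalAlg ν k : Set (ConfigSpace ν k →L[ℂ] ConfigSpace ν k)) :=
  StarSubalgebra.isClosed_topologicalClosure _

/-- The quasi-local algebra `𝒜_{ℤ^ν}` as a type. -/
def QuasiLocal (ν k : ℕ) : Type := quasiLocalAlg ν k

/-- The quasi-local algebra is a unital C⋆-algebra, with the operations and the norm of the
bounded operators. -/
instance (ν k : ℕ) : CStarAlgebra (QuasiLocal ν k) :=
  StarSubalgebra.cstarAlgebra (quasiLocalAlg ν k)

/-- The inclusion of the quasi-local algebra into the bounded operators. -/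
def QuasiLocal.incl (ν k : ℕ) :
    QuasiLocal ν k →⋆ₐ[ℂ] (ConfigSpace ν k →L[ℂ] ConfigSpace ν k) where
  toFun a := a.1
  map_one' := rfl
  map_mul' _ _ := rfl
  map_zero' := rfl
  map_add' _ _ := rfl
  commutes' _ := rfl
  map_star' _ := rfl

lemma QuasiLocal.incl_injective (ν k : ℕ) : Function.Injective (QuasiLocal.incl ν k) :=
  fun _ _ h => Subtype.ext h

lemma QuasiLocal.range_incl (ν k : ℕ) :
    Set.range (QuasiLocal.incl ν k) = quasiLocalAlg ν k :=
  Subtype.range_coe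

lemma QuasiLocal.norm_incl {ν k : ℕ} (a : QuasiLocal ν k) : ‖QuasiLocal.incl ν k a‖ = ‖a‖ := rfl

/-! ### Lattice translations -/

/-- The shiftVolume `τ_x(Λ) = {z + x : z ∈ Λ}` of a finite volume. -/
def shiftVolume {ν : ℕ} (x : Site ν) (Λ : Finset (Site ν)) : Finset (Site ν) :=
  Λ.map (addRightEmbedding x)

/-- The translation `σ ↦ σ(· - x)` of configurations. -/
def shiftConfig (ν k : ℕ) (x : Site ν) : Config ν k ≃ Config ν k where
  toFun σ := fun y => σ (y - x)
  invFun σ := fun y => σ (y + x)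
  left_inv σ := by funext y; simp
  right_inv σ := by funext y; simp

/-- The unitary on `ℓ²` of the configurations with `δ_σ ↦ δ_{σ(· - x)}`. -/
def shiftUnitary (ν k : ℕ) (x : Site ν) : ConfigSpace ν k ≃ₗᵢ[ℂ] ConfigSpace ν k where
  toFun f := ⟨fun σ => f ((shiftConfig ν k x).symm σ),
    memℓp_two ((shiftConfig ν k x).symm.summable_iff.2 (summable_normSq f))⟩
  invFun f := ⟨fun σ => f (shiftConfig ν k x σ),
    memℓp_two ((shiftConfig ν k x).summable_iff.2 (summable_normSq f))⟩
  left_inv f := by ext σ; simp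
  right_inv f := by ext σ; simp
  map_add' f g := by ext σ; rfl
  map_smul' c f := by ext σ; rfl
  norm_map' f := by
    rw [← sq_eq_sq₀ (norm_nonneg _) (norm_nonneg _), norm_sq_eq, norm_sq_eq]
    exact (shiftConfig ν k x).symm.tsum_eq (fun σ => ‖f σ‖ ^ 2)

lemma shiftUnitary_symm (ν k : ℕ) (x : Site ν) :
    (shiftUnitary ν k x).symm = shiftUnitary ν k (-x) := by
  ext f σ
  change f (fun y => σ (y - x)) = f (fun y => σ (y + -x))
  simp only [sub_eq_add_neg]

/-- Conjugation by the translation unitary. -/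
def conjShift (ν k : ℕ) (x : Site ν) :
    (ConfigSpace ν k →L[ℂ] ConfigSpace ν k) ≃⋆ₐ[ℂ] (ConfigSpace ν k →L[ℂ] ConfigSpace ν k) :=
  (shiftUnitary ν k x).conjStarAlgEquiv

lemma conjShift_symm (ν k : ℕ) (x : Site ν) :
    (conjShift ν k x).symm = conjShift ν k (-x) := by
  rw [conjShift, LinearIsometryEquiv.symm_conjStarAlgEquiv, shiftUnitary_symm]
  rfl

/-- Relabelling of the configurations in `τ_x(Λ)` by those in `Λ`. -/
def pullConfig {ν : ℕ} (k : ℕ) (x : Site ν) (Λ : Finset (Site ν)) :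
    LocalConfig k (shiftVolume x Λ) ≃ LocalConfig k Λ where
  toFun s := fun y => s ⟨y + x, by simp [shiftVolume]⟩
  invFun s := fun y => s ⟨y - x, by
    obtain ⟨y, hy⟩ := y
    obtain ⟨z, hz, rfl⟩ := Finset.mem_map.1 hy
    simpa using hz⟩
  left_inv s := by funext y; simp
  right_inv s := by funext y; simp

/-- On local observables, conjugation by the translation unitary relabels the sites `y ∈ Λ` as
`y + x`. -/
lemma conjShift_localEmbed {ν k : ℕ} (x : Site ν) {Λ : Finset (Site ν)}
    (m : Matrix (LocalConfig k Λ) (LocalConfig k Λ) ℂ) :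
    conjShift ν k x (localEmbed ν k Λ m) =
      localEmbed ν k (shiftVolume x Λ) (m.submatrix (pullConfig k x Λ) (pullConfig k x Λ)) := by
  ext f σ
  rw [localEmbed_apply]
  change ∑ s : LocalConfig k Λ, m (restrict Λ ((shiftConfig ν k x).symm σ)) s *
    f (shiftConfig ν k x (glue s ((shiftConfig ν k x).symm σ))) = _
  rw [← (pullConfig k x Λ).sum_comp]
  refine Finset.sum_congr rfl fun s _ => ?_
  have h1 : restrict Λ ((shiftConfig ν k x).symm σ) =
      pullConfig k x Λ (restrict (shiftVolume x Λ) σ) := rfl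
  have h2 : shiftConfig ν k x (glue (pullConfig k x Λ s) ((shiftConfig ν k x).symm σ)) =
      glue s σ := by
    funext y
    have : y - x ∈ Λ ↔ y ∈ shiftVolume x Λ := by
      simp only [shiftVolume, Finset.mem_map, addRightEmbedding_apply]
      exact ⟨fun h => ⟨_, h, sub_add_cancel y x⟩, by rintro ⟨z, hz, rfl⟩; simpa using hz⟩
    by_cases hy : y ∈ shiftVolume x Λ
    · simp [shiftConfig, glue, pullConfig, hy, this.2 hy]
    · simp [shiftConfig, glue, hy, this]
  rw [h1, h2]
  rfl

lemma conjShift_mem_localAlg {ν k : ℕ} (x : Site ν) {Λ : Finset (Site ν)}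
    {a : ConfigSpace ν k →L[ℂ] ConfigSpace ν k} (ha : a ∈ localAlg ν k Λ) :
    conjShift ν k x a ∈ localAlg ν k (shiftVolume x Λ) := by
  obtain ⟨m, rfl⟩ := ha
  exact ⟨_, (conjShift_localEmbed x m).symm⟩

lemma conjShift_mem {ν k : ℕ} (x : Site ν) {a : ConfigSpace ν k →L[ℂ] ConfigSpace ν k}
    (ha : a ∈ quasiLocalAlg ν k) : conjShift ν k x a ∈ quasiLocalAlg ν k := by
  have hc : Continuous (conjShift ν k x) := (StarAlgEquiv.isometry (conjShift ν k x)).continuous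
  refine map_mem_closure hc ha fun b hb => ?_
  obtain ⟨Λ, hΛ⟩ := mem_locAlg.1 hb
  exact mem_locAlg.2 ⟨_, conjShift_mem_localAlg x hΛ⟩

/-- The translation automorphism `τ_x` of the quasi-local algebra. -/
def tau {ν k : ℕ} (x : Site ν) : QuasiLocal ν k ≃⋆ₐ[ℂ] QuasiLocal ν k where
  toFun a := ⟨conjShift ν k x a.1, conjShift_mem x a.2⟩
  invFun a := ⟨conjShift ν k (-x) a.1, conjShift_mem (-x) a.2⟩
  left_inv a := by
    apply Subtype.ext
    simp only [← conjShift_symm, StarAlgEquiv.symm_apply_apply]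
  right_inv a := by
    apply Subtype.ext
    simp only [← conjShift_symm, StarAlgEquiv.apply_symm_apply]
  map_mul' a b := Subtype.ext (map_mul (conjShift ν k x) a.1 b.1)
  map_add' a b := Subtype.ext (map_add (conjShift ν k x) a.1 b.1)
  map_star' a := Subtype.ext (map_star (conjShift ν k x) a.1)
  map_smul' c a := Subtype.ext (map_smul (conjShift ν k x) c a.1)

lemma incl_tau {ν k : ℕ} (x : Site ν) (a : QuasiLocal ν k) :
    QuasiLocal.incl ν k (tau x a) = conjShift ν k x (QuasiLocal.incl ν k a) := rfl

/-! ### Local dynamics -/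

/-- The finite-volume Hamiltonian `H^Λ = ∑_{Z ⊆ Λ} h(Z)`. -/
def localHamiltonian {ν k : ℕ} (h : Finset (Site ν) → QuasiLocal ν k)
    (Λ : Finset (Site ν)) : QuasiLocal ν k :=
  ∑ Z ∈ Λ.powerset, h Z

/-- The propagator `U^Λ(t) = exp(-i t H^Λ)`. -/
def propagator {ν k : ℕ} (h : Finset (Site ν) → QuasiLocal ν k)
    (Λ : Finset (Site ν)) (t : ℝ) : QuasiLocal ν k :=
  NormedSpace.exp ((-(Complex.I * t)) • localHamiltonian h Λ)

/-- The Heisenberg dynamics `α^Λ_t(a) = U^Λ(-t) a U^Λ(t)`. -/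
def localDynamics {ν k : ℕ} (h : Finset (Site ν) → QuasiLocal ν k)
    (Λ : Finset (Site ν)) (t : ℝ) (a : QuasiLocal ν k) : QuasiLocal ν k :=
  propagator h Λ (-t) * a * propagator h Λ t

/-- An increasing and absorbing sequence of finite volumes. -/
structure IsIAS {ν : ℕ} (Λ : ℕ → Finset (Site ν)) : Prop where
  mono : ∀ n, Λ n ⊆ Λ (n + 1)
  absorbing : ∀ x, ∃ n, x ∈ Λ n

/-- `α` is the thermodynamic limit of the local dynamics of the interaction `h`: along every
increasing and absorbing sequence of finite volumes, `α_t` is the strong limit of `α^{Λ_n}_t`. -/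
def IsThermodynamicLimit {ν k : ℕ} (h : Finset (Site ν) → QuasiLocal ν k)
    (α : ℝ → QuasiLocal ν k ≃⋆ₐ[ℂ] QuasiLocal ν k) : Prop :=
  ∀ Λ : ℕ → Finset (Site ν), IsIAS Λ → ∀ (t : ℝ) (a : QuasiLocal ν k),
    Tendsto (fun n => localDynamics h (Λ n) t a) atTop (𝓝 (α t a))

/-! ### `F`-functions and the `F`-norm -/

/-- `F : [0,∞) → (0,∞)` is an `F`-function on `ℤ^ν` with the `ℓ^∞` metric: it is non-increasing,
uniformly summable, and satisfies the convolution condition. -/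
structure IsFFunction (ν : ℕ) (F : ℝ≥0 → ℝ≥0) : Prop where
  pos : ∀ r, 0 < F r
  antitone : Antitone F
  summable : ⨆ x : Site ν, ∑' y : Site ν, (F (nndist x y) : ℝ≥0∞) < ∞
  convolution : ∃ C : ℝ≥0, 0 < C ∧ ∀ x y : Site ν,
    ∑' z : Site ν, (F (nndist x z) : ℝ≥0∞) * F (nndist z y) ≤ C * F (nndist x y)

/-- The `F`-norm `sup_{x,y} ∑_{Z ∋ x,y} ‖h(Z)‖ F(d(x,y))⁻¹ ∈ [0,∞]` of an interaction. -/
def FNorm {ν k : ℕ} (F : ℝ≥0 → ℝ≥0) (h : Finset (Site ν) → QuasiLocal ν k) : ℝ≥0∞ :=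
  ⨆ (x : Site ν) (y : Site ν), ∑' Z : {Z : Finset (Site ν) // x ∈ Z ∧ y ∈ Z},
    ‖h Z‖ₑ * (F (nndist x y) : ℝ≥0∞)⁻¹

/-! ### Disordered and ergodic interactions -/

/-- A disordered interaction: for each finite `Z`, `h(ω, Z)` is almost surely a self-adjoint
element of `𝒜_Z`, and `ω ↦ h(ω, Z)` is weakly measurable. -/
structure IsDisorderedInteraction {Ω : Type*} [MeasurableSpace Ω] (P : Measure Ω) {ν k : ℕ}
    (h : Ω → Finset (Site ν) → QuasiLocal ν k) : Prop where
  local_selfAdjoint : ∀ Z, ∀ᵐ ω ∂P, IsSelfAdjoint (h ω Z) ∧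
    QuasiLocal.incl ν k (h ω Z) ∈ localAlg ν k Z
  weakly_measurable : ∀ (Z : Finset (Site ν)) (φ : StrongDual ℂ (QuasiLocal ν k)),
    Measurable fun ω => φ (h ω Z)

/-- An ergodic interaction, with respect to an action `(x, ω) ↦ ϑ_x ω = x +ᵥ ω` of `ℤ^ν` on the
probability space: the action is measurable, measure preserving and ergodic, and
`τ_x(h(ω, Z)) = h(ϑ_x ω, τ_x(Z))`. -/
structure IsErgodicInteraction {Ω : Type*} [MeasurableSpace Ω] (P : Measure Ω) {ν k : ℕ}
    [AddAction (Site ν) Ω] (h : Ω → Finset (Site ν) → QuasiLocal ν k) : Prop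
    extends IsDisorderedInteraction P h where
  measurable_action : ∀ x : Site ν, Measurable fun ω : Ω => x +ᵥ ω
  ergodic_action : ErgodicVAdd (Site ν) Ω P
  covariant : ∀ (x : Site ν) (Z : Finset (Site ν)), ∀ᵐ ω ∂P,
    tau x (h ω Z) = h (x +ᵥ ω) (shiftVolume x Z)

end SpinSystem

end

open SpinSystem

/-!
# Thermodynamic limit of the dynamics of an ergodic interaction

Constancy of the `F`-norm. The quasi-local algebra is separable, so a weakly measurable interaction
is strongly measurable (`stronglyMeasurable_of_forall_dual`) and its `F`-norm is a measurable
function of `ω`. Translations are isometric, so covariance makes this function invariant under the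
action, and ergodicity makes it almost surely constant; the constant is finite because the norm is
finite with positive probability.

Existence of the limit for a fixed `ω` of finite `F`-norm. Let `a` be supported in `X`, let `H` be
the Hamiltonian of a volume `Λ ⊇ X` and `K` the sum of its terms meeting `X`. As `H - K` commutes
with `a`, passing to the interaction picture shows that `[α_t(a), b]` has norm at most
`‖[a, b]‖ + 2 ‖a‖ ∫₀ᵗ ‖[α_s(K), b]‖ ds` (`norm_commutator_heisenberg_le`). With the weight
`w_Y(V) = ∑_{v ∈ V, y ∈ Y} F(d(v, y))`, the `F`-norm bound `N` and the convolution constant `C`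
give `∑_{Z ∩ V ≠ ∅} ‖h(Z)‖ w_Y(Z) ≤ N C w_Y(V)` (`IsFBounded.sum_norm_mul_weight_le`). Hence an
estimate `‖[α_t(a), b]‖ ≤ κ ‖a‖ ‖b‖ e^{4NCt} w_Y(X)`, valid for all `X ⊆ Λ`, improves itself: `κ`
may be replaced by `2 / F(0) + κ / 2`. In a finite volume some `κ` is admissible, so the fixed point
`κ = 4 / F(0)` is, whatever the volume; this is the Lieb-Robinson bound `hasPropagationBound`.

By Duhamel's formula the dynamics of `Λ ⊆ Λ'` differ on `a` by the time integral of commutators of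
`α_s(a)` with the terms of `H^{Λ'} - H^Λ`, which all meet `Λ' \ Λ`. The Lieb-Robinson bound and the
same weighted sum bound the difference by a constant times `w_X(Λ' \ Λ)`, a piece of the tail of a
convergent series. So `α^Λ_t(a)` is Cauchy along the directed set of finite volumes, first for local
`a`, then for all `a` because the dynamics are isometric. The limit is an automorphism with inverse
the limit at time `-t`.

Covariance holds because translating an exhausting sequence of volumes gives another one, and
measurability because the limit is taken along one fixed sequence of volumes.
-/

/-! ### Heisenberg dynamics in a C⋆-algebra -/

section Heisenberg

variable {A : Type*} [CStarAlgebra A]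

/-- The one-parameter group `t ↦ exp(i t H)` generated by an element `H` of a C⋆-algebra. -/
noncomputable def expGroup (H : A) (t : ℝ) : A := NormedSpace.exp (t • (Complex.I • H))

/-- The Heisenberg evolution `a ↦ exp(i t H) a exp(-i t H)`. -/
noncomputable def heisenberg (H : A) (t : ℝ) (a : A) : A :=
  expGroup H t * a * expGroup H (-t)

lemma expGroup_zero (H : A) : expGroup H 0 = 1 := by
  simp [expGroup]

lemma expGroup_add (H : A) (s t : ℝ) : expGroup H (s + t) = expGroup H s * expGroup H t := by
  let _ : NormedAlgebra ℚ A := .restrictScalars ℚ ℂ A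
  rw [expGroup, add_smul]
  exact NormedSpace.exp_add_of_commute
    (((Commute.refl (Complex.I • H)).smul_left s).smul_right t)

lemma expGroup_mul_neg (H : A) (t : ℝ) : expGroup H t * expGroup H (-t) = 1 := by
  rw [← expGroup_add, add_neg_cancel, expGroup_zero]

lemma expGroup_neg_mul (H : A) (t : ℝ) : expGroup H (-t) * expGroup H t = 1 := by
  rw [← expGroup_add, neg_add_cancel, expGroup_zero]

lemma expGroup_neg_left (H : A) (t : ℝ) : expGroup (-H) t = expGroup H (-t) := by
  simp [expGroup]

lemma star_expGroup {H : A} (hH : IsSelfAdjoint H) (t : ℝ) :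
    star (expGroup H t) = expGroup H (-t) := by
  let _ : NormedAlgebra ℚ A := .restrictScalars ℚ ℂ A
  rw [expGroup, NormedSpace.star_exp, expGroup]
  congr 1
  simp [star_smul, hH.star_eq]

lemma expGroup_mem_unitary {H : A} (hH : IsSelfAdjoint H) (t : ℝ) :
    expGroup H t ∈ unitary A := by
  rw [Unitary.mem_iff, star_expGroup hH]
  exact ⟨expGroup_neg_mul H t, expGroup_mul_neg H t⟩

lemma Commute.expGroup_left {H a : A} (h : Commute H a) (t : ℝ) : Commute (expGroup H t) a := by
  let _ : NormedAlgebra ℚ A := .restrictScalars ℚ ℂ A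
  exact ((h.smul_left Complex.I).smul_left t).exp_left

lemma hasDerivAt_expGroup (H : A) (t : ℝ) :
    HasDerivAt (expGroup H) (expGroup H t * (Complex.I • H)) t :=
  hasDerivAt_exp_smul_const (Complex.I • H) t

lemma hasDerivAt_expGroup_neg (H : A) (t : ℝ) :
    HasDerivAt (fun s => expGroup H (-s)) (-((Complex.I • H) * expGroup H (-t))) t := by
  have h := (hasDerivAt_exp_smul_const' (𝕂 := ℝ) (Complex.I • H) (-t)).scomp t (hasDerivAt_neg t)
  refine h.congr_deriv ?_
  simp [expGroup]

lemma heisenberg_neg_left (H : A) (t : ℝ) (a : A) :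
    heisenberg (-H) t a = heisenberg H (-t) a := by
  simp only [heisenberg, expGroup_neg_left, neg_neg]

lemma heisenberg_zero (H a : A) : heisenberg H 0 a = a := by
  simp [heisenberg, expGroup_zero]

lemma heisenberg_add (H : A) (t : ℝ) (a b : A) :
    heisenberg H t (a + b) = heisenberg H t a + heisenberg H t b := by
  simp only [heisenberg, mul_add, add_mul]

lemma heisenberg_sub (H : A) (t : ℝ) (a b : A) :
    heisenberg H t (a - b) = heisenberg H t a - heisenberg H t b := by
  simp only [heisenberg, mul_sub, sub_mul]

lemma heisenberg_smul (H : A) (t : ℝ) (c : ℂ) (a : A) :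
    heisenberg H t (c • a) = c • heisenberg H t a := by
  simp only [heisenberg, mul_smul_comm, smul_mul_assoc]

lemma heisenberg_mul (H : A) (t : ℝ) (a b : A) :
    heisenberg H t (a * b) = heisenberg H t a * heisenberg H t b := by
  have h := expGroup_neg_mul H t
  calc heisenberg H t (a * b)
      = expGroup H t * a * 1 * b * expGroup H (-t) := by simp only [heisenberg, mul_one, mul_assoc]
    _ = heisenberg H t a * heisenberg H t b := by
      rw [← h]; simp only [heisenberg, mul_assoc]

lemma heisenberg_star {H : A} (hH : IsSelfAdjoint H) (t : ℝ) (a : A) :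
    heisenberg H t (star a) = star (heisenberg H t a) := by
  simp only [heisenberg, star_mul, star_expGroup hH, neg_neg, mul_assoc]

lemma heisenberg_heisenberg_neg (H : A) (t : ℝ) (a : A) :
    heisenberg H t (heisenberg H (-t) a) = a := by
  calc heisenberg H t (heisenberg H (-t) a)
      = (expGroup H t * expGroup H (-t)) * a * (expGroup H t * expGroup H (-t)) := by
        simp only [heisenberg, neg_neg, mul_assoc]
    _ = a := by rw [expGroup_mul_neg, one_mul, mul_one]

lemma norm_heisenberg {H : A} (hH : IsSelfAdjoint H) (t : ℝ) (a : A) :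
    ‖heisenberg H t a‖ = ‖a‖ := by
  rw [heisenberg, CStarRing.norm_mul_mem_unitary _ (expGroup_mem_unitary hH _),
    CStarRing.norm_mem_unitary_mul _ (expGroup_mem_unitary hH _)]

lemma heisenberg_of_commute {H a : A} (h : Commute H a) (t : ℝ) : heisenberg H t a = a := by
  rw [heisenberg, (h.expGroup_left t).eq, mul_assoc, expGroup_mul_neg, mul_one]

lemma heisenberg_commutator (H : A) (t : ℝ) (a b : A) :
    heisenberg H t ⁅a, b⁆ = ⁅heisenberg H t a, heisenberg H t b⁆ := by
  simp only [Ring.lie_def, heisenberg_sub, heisenberg_mul]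

lemma norm_commutator_heisenberg {H : A} (hH : IsSelfAdjoint H) (t : ℝ) (a b : A) :
    ‖⁅heisenberg H t a, b⁆‖ = ‖⁅a, heisenberg H (-t) b⁆‖ := by
  conv_lhs => rw [← heisenberg_heisenberg_neg H t b, ← heisenberg_commutator]
  exact norm_heisenberg hH t _

lemma norm_neg_commutator (a b : A) : ‖⁅-a, b⁆‖ = ‖⁅a, b⁆‖ := by
  rw [← norm_neg, Ring.lie_def, Ring.lie_def]
  congr 1
  noncomm_ring

lemma norm_commutator_comm (a b : A) : ‖⁅a, b⁆‖ = ‖⁅b, a⁆‖ := by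
  rw [← norm_neg, Ring.lie_def, Ring.lie_def, neg_sub]

lemma norm_commutator_le (a b : A) : ‖⁅a, b⁆‖ ≤ 2 * ‖a‖ * ‖b‖ := by
  rw [Ring.lie_def]
  have h1 := norm_mul_le a b
  have h2 := norm_mul_le b a
  have h3 := norm_sub_le (a * b) (b * a)
  linarith [mul_comm ‖a‖ ‖b‖]

lemma commutator_sum_left {ι : Type*} (S : Finset ι) (f : ι → A) (b : A) :
    ⁅∑ i ∈ S, f i, b⁆ = ∑ i ∈ S, ⁅f i, b⁆ := by
  simp only [Ring.lie_def, Finset.mul_sum, Finset.sum_mul, Finset.sum_sub_distrib]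

lemma commutator_sum_right {ι : Type*} (S : Finset ι) (f : ι → A) (b : A) :
    ⁅b, ∑ i ∈ S, f i⁆ = ∑ i ∈ S, ⁅b, f i⁆ := by
  simp only [Ring.lie_def, Finset.mul_sum, Finset.sum_mul, Finset.sum_sub_distrib]

lemma heisenberg_sum {ι : Type*} (H : A) (t : ℝ) (S : Finset ι) (f : ι → A) :
    heisenberg H t (∑ i ∈ S, f i) = ∑ i ∈ S, heisenberg H t (f i) := by
  simp only [heisenberg, Finset.mul_sum, Finset.sum_mul]

/-- The derivative of one dynamics composed with the inverse of another is governed by the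
commutator with the difference of the generators. -/
lemma hasDerivAt_heisenberg_heisenberg (P Q b : A) (t : ℝ) :
    HasDerivAt (fun s => heisenberg P s (heisenberg Q (-s) b))
      (heisenberg P t (Complex.I • ⁅P - Q, heisenberg Q (-t) b⁆)) t := by
  have hQ : HasDerivAt (fun s => heisenberg Q (-s) b)
      (-(Complex.I • ⁅Q, heisenberg Q (-t) b⁆)) t := by
    have h := ((hasDerivAt_expGroup_neg Q t).mul_const b).mul (hasDerivAt_expGroup Q t)
    have e : (fun s => heisenberg Q (-s) b) =
        (fun s => expGroup Q (-s) * b) * expGroup Q := by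
      funext s; simp [heisenberg]
    rw [e]
    refine h.congr_deriv ?_
    simp only [heisenberg, Ring.lie_def, neg_neg, smul_sub, mul_smul_comm, smul_mul_assoc, neg_mul,
      mul_assoc]
    abel
  have h := ((hasDerivAt_expGroup P t).mul hQ).mul (hasDerivAt_expGroup_neg P t)
  refine h.congr_deriv ?_
  simp only [heisenberg, Ring.lie_def, neg_neg, smul_sub, mul_smul_comm, smul_mul_assoc, neg_mul,
    mul_assoc, sub_mul, mul_sub, mul_neg, add_mul, Pi.mul_apply]
  abel

/-- If `H - K` commutes with `a`, then in the interaction picture only the part `K` of the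
generator moves `a`, so the growth of `[α_t(a), b]` is bounded by the commutators `[α_s(K), b]`. -/
lemma norm_commutator_heisenberg_le {H K a b : A} (hH : IsSelfAdjoint H) (hK : IsSelfAdjoint K)
    (hc : Commute (H - K) a) {Φ Φ' : ℝ → ℝ} (hΦ : ∀ s, HasDerivAt Φ (Φ' s) s) {T : ℝ}
    (hb : ∀ s ∈ Set.Ico 0 T, ‖⁅heisenberg H s K, b⁆‖ ≤ Φ' s) (t : ℝ) (ht : t ∈ Set.Icc 0 T) :
    ‖⁅heisenberg H t a, b⁆‖ ≤ ‖⁅a, b⁆‖ + 2 * ‖a‖ * (Φ t - Φ 0) := by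
  have hHK : IsSelfAdjoint (H - K) := hH.sub hK
  set G : ℝ → A := fun s => heisenberg (H - K) s (heisenberg H (-s) b) with hG
  have hG' := hasDerivAt_heisenberg_heisenberg (H - K) H b
  have h1 : ∀ s, ‖⁅heisenberg H s a, b⁆‖ = ‖⁅a, G s⁆‖ := fun s => by
    rw [norm_commutator_heisenberg hH, ← norm_heisenberg hHK s, heisenberg_commutator,
      heisenberg_of_commute hc]
  have h2 : ∀ s ∈ Set.Ico 0 T,
      ‖heisenberg (H - K) s (Complex.I • ⁅H - K - H, heisenberg H (-s) b⁆)‖ ≤ Φ' s := fun s hs => by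
    rw [norm_heisenberg hHK, norm_smul, Complex.norm_I, one_mul, sub_sub_cancel_left,
      norm_neg_commutator, ← norm_commutator_heisenberg hH]
    exact hb s hs
  have h3 : ‖G t - G 0‖ ≤ Φ t - Φ 0 := by
    refine image_norm_le_of_norm_deriv_right_le_deriv_boundary (a := 0) (b := T)
      (f := fun s => G s - G 0) (B := fun s => Φ s - Φ 0)
      (fun s _ => ((hG' s).sub_const _).continuousAt.continuousWithinAt)
      (fun s _ => ((hG' s).sub_const _).hasDerivWithinAt) (by simp)
      (fun s => (hΦ s).sub_const _) (fun s hs => h2 s hs) ht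
  have h4 : G 0 = b := by simp [hG, heisenberg_zero]
  have h5 : ⁅a, G t⁆ = ⁅a, b⁆ + ⁅a, G t - G 0⁆ := by
    rw [h4]; simp only [Ring.lie_def]; noncomm_ring
  rw [h1, h5]
  refine (norm_add_le _ _).trans (add_le_add le_rfl ((norm_commutator_le _ _).trans ?_))
  gcongr

/-- Duhamel's estimate for the difference of two dynamics. -/
lemma norm_heisenberg_sub_le {H₁ H₂ a : A} (h₁ : IsSelfAdjoint H₁)
    {M T : ℝ} (hT : 0 ≤ T)
    (hM : ∀ s ∈ Set.Ico 0 T, ‖⁅heisenberg H₂ s a, H₂ - H₁⁆‖ ≤ M) :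
    ‖heisenberg H₂ T a - heisenberg H₁ T a‖ ≤ M * T := by
  have hd := hasDerivAt_heisenberg_heisenberg (-H₁) (-H₂) a
  have h := norm_image_sub_le_of_norm_deriv_le_segment' (a := 0) (b := T)
    (fun s _ => (hd s).hasDerivWithinAt) (C := M) (fun s hs => by
      rw [norm_heisenberg h₁.neg, norm_smul, Complex.norm_I, one_mul, heisenberg_neg_left, neg_neg,
        norm_commutator_comm, show -H₁ - -H₂ = H₂ - H₁ by abel]
      exact hM s hs) T (Set.right_mem_Icc.2 hT)
  simp only [heisenberg_neg_left, neg_neg, neg_zero, heisenberg_zero, sub_zero] at h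
  rw [← norm_heisenberg h₁ T, heisenberg_sub, heisenberg_heisenberg_neg] at h
  exact h

end Heisenberg

/-! ### Locality -/

section Locality

variable {ν k : ℕ}

lemma glue_comm {X Y : Finset (Site ν)} (hXY : Disjoint X Y) (s : LocalConfig k X)
    (t : LocalConfig k Y) (σ : Config ν k) : glue s (glue t σ) = glue t (glue s σ) := by
  funext x
  by_cases hx : x ∈ X
  · simp [glue, hx, Finset.disjoint_left.1 hXY hx]
  · simp [glue, hx]

lemma restrict_glue_of_disjoint {X Y : Finset (Site ν)} (hXY : Disjoint X Y)
    (t : LocalConfig k Y) (σ : Config ν k) : restrict X (glue t σ) = restrict X σ := by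
  funext x
  simp [glue, restrict, Finset.disjoint_left.1 hXY x.2]

lemma commute_localEmbed {X Y : Finset (Site ν)} (hXY : Disjoint X Y)
    (m : Matrix (LocalConfig k X) (LocalConfig k X) ℂ)
    (n : Matrix (LocalConfig k Y) (LocalConfig k Y) ℂ) :
    Commute (localEmbed ν k X m) (localEmbed ν k Y n) := by
  ext f σ
  simp only [mul_apply_eq_comp, localEmbed_apply, restrict_glue_of_disjoint hXY,
    restrict_glue_of_disjoint hXY.symm, Finset.mul_sum]
  rw [Finset.sum_comm]
  refine Finset.sum_congr rfl fun t _ => Finset.sum_congr rfl fun s _ => ?_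
  rw [glue_comm hXY.symm]
  ring

/-- Observables with disjoint supports commute. -/
lemma commute_of_disjoint {X Y : Finset (Site ν)} (hXY : Disjoint X Y) {a b : QuasiLocal ν k}
    (ha : QuasiLocal.incl ν k a ∈ localAlg ν k X) (hb : QuasiLocal.incl ν k b ∈ localAlg ν k Y) :
    Commute a b := by
  obtain ⟨m, hm⟩ := ha
  obtain ⟨n, hn⟩ := hb
  apply QuasiLocal.incl_injective ν k
  rw [map_mul, map_mul, ← hm, ← hn]
  exact commute_localEmbed hXY m n

end Locality

/-! ### Lieb-Robinson bound -/

section LiebRobinson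

variable {ν k : ℕ}

/-- The total interaction weight `∑_{v ∈ V} ∑_{y ∈ Y} F(d(v,y))` between two finite volumes. -/
def weight (F : ℝ≥0 → ℝ≥0) (Y V : Finset (Site ν)) : ℝ :=
  ∑ v ∈ V, ∑ y ∈ Y, (F (nndist v y) : ℝ)

lemma weight_nonneg (F : ℝ≥0 → ℝ≥0) (Y V : Finset (Site ν)) : 0 ≤ weight F Y V :=
  Finset.sum_nonneg fun _ _ => Finset.sum_nonneg fun _ _ => NNReal.coe_nonneg _

lemma weight_comm (F : ℝ≥0 → ℝ≥0) (Y V : Finset (Site ν)) : weight F Y V = weight F V Y := by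
  rw [weight, weight, Finset.sum_comm]
  simp only [nndist_comm]

lemma le_weight (F : ℝ≥0 → ℝ≥0) {Y V : Finset (Site ν)} {v y : Site ν} (hv : v ∈ V)
    (hy : y ∈ Y) : (F (nndist v y) : ℝ) ≤ weight F Y V :=
  (Finset.single_le_sum (f := fun y => (F (nndist v y) : ℝ))
    (fun _ _ => NNReal.coe_nonneg _) hy).trans
  (Finset.single_le_sum (f := fun v => ∑ y ∈ Y, (F (nndist v y) : ℝ))
    (fun _ _ => Finset.sum_nonneg fun _ _ => NNReal.coe_nonneg _) hv)

/-- The properties of an interaction used in finite volume: every term is self-adjoint and local,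
and `N` bounds the `F`-norm, in the form of a bound on finite sums. -/
structure IsFBounded (F : ℝ≥0 → ℝ≥0) (N : ℝ) (h : Finset (Site ν) → QuasiLocal ν k) : Prop where
  selfAdjoint : ∀ Z, IsSelfAdjoint (h Z)
  isLocal : ∀ Z, QuasiLocal.incl ν k (h Z) ∈ localAlg ν k Z
  pos : 0 < N
  sum_le : ∀ (x y : Site ν) (S : Finset (Finset (Site ν))), (∀ Z ∈ S, x ∈ Z ∧ y ∈ Z) →
    ∑ Z ∈ S, ‖h Z‖ ≤ N * F (nndist x y)

/-- The convolution condition of an `F`-function with constant `C`, for finite sums. -/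
def HasConvolutionBound (ν : ℕ) (F : ℝ≥0 → ℝ≥0) (C : ℝ) : Prop :=
  0 < C ∧ ∀ (x y : Site ν) (S : Finset (Site ν)),
    ∑ z ∈ S, (F (nndist x z) : ℝ) * F (nndist z y) ≤ C * F (nndist x y)

variable {F : ℝ≥0 → ℝ≥0} {N C : ℝ} {h : Finset (Site ν) → QuasiLocal ν k}

lemma IsFBounded.neg (hh : IsFBounded F N h) : IsFBounded F N (-h) where
  selfAdjoint Z := (hh.selfAdjoint Z).neg
  isLocal Z := by
    rw [Pi.neg_apply, map_neg]
    exact neg_mem (hh.isLocal Z)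
  pos := hh.pos
  sum_le x y S hS := by simpa using hh.sum_le x y S hS

lemma IsFBounded.isSelfAdjoint_sum (hh : IsFBounded F N h) (S : Finset (Finset (Site ν))) :
    IsSelfAdjoint (∑ Z ∈ S, h Z) :=
  _root_.isSelfAdjoint_sum S fun Z _ => hh.selfAdjoint Z

lemma localHamiltonian_neg (h : Finset (Site ν) → QuasiLocal ν k) (Λ : Finset (Site ν)) :
    localHamiltonian (-h) Λ = -localHamiltonian h Λ :=
  Finset.sum_neg_distrib _

open Classical in
/-- The terms of the interaction that meet a volume `V` carry, weighted by their distance to `Y`,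
at most the weight of `V` itself: this is where the `F`-norm and the convolution condition are
combined. -/
lemma IsFBounded.sum_norm_mul_weight_le (hh : IsFBounded F N h)
    (hC : HasConvolutionBound ν F C) (Λ V Y : Finset (Site ν)) :
    ∑ Z ∈ Λ.powerset with ¬ Disjoint Z V, ‖h Z‖ * weight F Y Z ≤ N * C * weight F Y V := by
  have hsite : ∀ v, ∑ Z ∈ Λ.powerset with v ∈ Z, ‖h Z‖ * weight F Y Z
      ≤ N * C * ∑ y ∈ Y, (F (nndist v y) : ℝ) := by
    intro v
    calc ∑ Z ∈ Λ.powerset with v ∈ Z, ‖h Z‖ * weight F Y Z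
        = ∑ Z ∈ Λ.powerset with v ∈ Z, ∑ z ∈ Λ,
            if z ∈ Z then ‖h Z‖ * ∑ y ∈ Y, (F (nndist z y) : ℝ) else 0 := by
          refine Finset.sum_congr rfl fun Z hZ => ?_
          have hZ' : Z ⊆ Λ := Finset.mem_powerset.1 (Finset.mem_filter.1 hZ).1
          rw [← Finset.sum_filter, Finset.filter_mem_eq_inter, Finset.inter_eq_right.2 hZ', weight,
            Finset.mul_sum]
      _ = ∑ z ∈ Λ, (∑ Z ∈ {Z ∈ Λ.powerset | v ∈ Z} with z ∈ Z, ‖h Z‖) *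
            ∑ y ∈ Y, (F (nndist z y) : ℝ) := by
          rw [Finset.sum_comm]
          refine Finset.sum_congr rfl fun z _ => ?_
          rw [← Finset.sum_filter, Finset.sum_mul]
      _ ≤ ∑ z ∈ Λ, (N * F (nndist v z)) * ∑ y ∈ Y, (F (nndist z y) : ℝ) := by
          refine Finset.sum_le_sum fun z _ => mul_le_mul_of_nonneg_right ?_
            (Finset.sum_nonneg fun _ _ => NNReal.coe_nonneg _)
          exact hh.sum_le v z _ fun Z hZ => by
            simp only [Finset.mem_filter] at hZ
            exact ⟨hZ.1.2, hZ.2⟩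
      _ = N * ∑ y ∈ Y, ∑ z ∈ Λ, (F (nndist v z) : ℝ) * F (nndist z y) := by
          rw [Finset.sum_comm, Finset.mul_sum]
          refine Finset.sum_congr rfl fun z _ => ?_
          rw [Finset.mul_sum, Finset.mul_sum]
          exact Finset.sum_congr rfl fun y _ => by ring
      _ ≤ N * ∑ y ∈ Y, C * (F (nndist v y) : ℝ) :=
          mul_le_mul_of_nonneg_left (Finset.sum_le_sum fun y _ => hC.2 v y Λ) hh.pos.le
      _ = N * C * ∑ y ∈ Y, (F (nndist v y) : ℝ) := by rw [← Finset.mul_sum, mul_assoc]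
  have hnn : ∀ Z, 0 ≤ ‖h Z‖ * weight F Y Z := fun Z =>
    mul_nonneg (norm_nonneg _) (weight_nonneg F Y Z)
  calc ∑ Z ∈ Λ.powerset with ¬ Disjoint Z V, ‖h Z‖ * weight F Y Z
      ≤ ∑ Z ∈ Λ.powerset, ∑ v ∈ V, if v ∈ Z then ‖h Z‖ * weight F Y Z else 0 := by
        rw [Finset.sum_filter]
        refine Finset.sum_le_sum fun Z _ => ?_
        have hnn' : ∀ v ∈ V, 0 ≤ if v ∈ Z then ‖h Z‖ * weight F Y Z else 0 := fun v _ => by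
          split_ifs
          exacts [hnn Z, le_rfl]
        split_ifs with hd
        · exact Finset.sum_nonneg hnn'
        · obtain ⟨v, hvZ, hvV⟩ := Finset.not_disjoint_iff.1 hd
          have := Finset.single_le_sum hnn' hvV
          rwa [if_pos hvZ] at this
    _ = ∑ v ∈ V, ∑ Z ∈ Λ.powerset with v ∈ Z, ‖h Z‖ * weight F Y Z := by
        rw [Finset.sum_comm]
        simp only [Finset.sum_filter]
    _ ≤ ∑ v ∈ V, N * C * ∑ y ∈ Y, (F (nndist v y) : ℝ) := Finset.sum_le_sum fun v _ => hsite v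
    _ = N * C * weight F Y V := by rw [weight, Finset.mul_sum]

/-- The propagation estimate `‖[α^Λ_t(a), b]‖ ≤ K ‖a‖ ‖b‖ e^{4NCt} ∑_{x ∈ X, y ∈ Y} F(d(x,y))`,
for all `a` supported in some `X ⊆ Λ`, with `b` and its support `Y` fixed. -/
def HasPropagationBound (F : ℝ≥0 → ℝ≥0) (N C : ℝ) (h : Finset (Site ν) → QuasiLocal ν k)
    (Λ Y : Finset (Site ν)) (b : QuasiLocal ν k) (K : ℝ) : Prop :=
  ∀ X ⊆ Λ, ∀ a : QuasiLocal ν k, QuasiLocal.incl ν k a ∈ localAlg ν k X → ∀ t : ℝ, 0 ≤ t →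
    ‖⁅heisenberg (localHamiltonian h Λ) t a, b⁆‖ ≤
      K * ‖a‖ * ‖b‖ * Real.exp (4 * N * C * t) * weight F Y X

lemma norm_commutator_le_weight (hF : 0 < F 0) {X Y : Finset (Site ν)} {a b : QuasiLocal ν k}
    (ha : QuasiLocal.incl ν k a ∈ localAlg ν k X)
    (hb : QuasiLocal.incl ν k b ∈ localAlg ν k Y) :
    ‖⁅a, b⁆‖ ≤ 2 / F 0 * ‖a‖ * ‖b‖ * weight F Y X := by
  have hF' : (0 : ℝ) < F 0 := NNReal.coe_pos.2 hF
  have hw := weight_nonneg F Y X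
  by_cases hXY : Disjoint X Y
  · rw [Ring.lie_def, (commute_of_disjoint hXY ha hb).eq, sub_self, norm_zero]
    positivity
  · obtain ⟨x, hxX, hxY⟩ := Finset.not_disjoint_iff.1 hXY
    have h1 : (F 0 : ℝ) ≤ weight F Y X := by simpa using le_weight F hxX hxY
    calc ‖⁅a, b⁆‖ ≤ 2 * ‖a‖ * ‖b‖ := norm_commutator_le a b
      _ = 2 / F 0 * ‖a‖ * ‖b‖ * F 0 := by field_simp
      _ ≤ _ := by gcongr

open Classical in
/-- One Picard iteration of the propagation estimate. The rate `4NC` in the exponential is twice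
what Grönwall's inequality would give, so that the iteration contracts the constant. -/
lemma HasPropagationBound.step (hF : 0 < F 0) (hh : IsFBounded F N h)
    (hC : HasConvolutionBound ν F C) {Λ Y : Finset (Site ν)} {b : QuasiLocal ν k}
    (hb : QuasiLocal.incl ν k b ∈ localAlg ν k Y) {K : ℝ} (hK : 0 ≤ K)
    (hP : HasPropagationBound F N C h Λ Y b K) :
    HasPropagationBound F N C h Λ Y b (2 / F 0 + K / 2) := by
  intro X hX a ha t ht
  have hNC : 0 < N * C := mul_pos hh.pos hC.1
  have hw := weight_nonneg F Y X
  set H := localHamiltonian h Λ with hH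
  set HX : QuasiLocal ν k := ∑ Z ∈ Λ.powerset with ¬ Disjoint Z X, h Z with hHX
  have hsub : H - HX = ∑ Z ∈ Λ.powerset with Disjoint Z X, h Z := by
    rw [hH, hHX, localHamiltonian, sub_eq_iff_eq_add,
      Finset.sum_filter_add_sum_filter_not]
  have hcomm : Commute (H - HX) a := by
    rw [hsub]
    exact Commute.sum_left _ _ _ fun Z hZ =>
      commute_of_disjoint (Finset.mem_filter.1 hZ).2 (hh.isLocal Z) ha
  set c : ℝ := K * ‖b‖ * weight F Y X with hc
  have hΦ : ∀ s, HasDerivAt (fun s => c / 4 * Real.exp (4 * N * C * s))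
      (N * C * c * Real.exp (4 * N * C * s)) s := fun s => by
    have := (((hasDerivAt_id s).const_mul (4 * N * C)).exp).const_mul (c / 4)
    refine this.congr_deriv ?_
    simp only [id]
    ring
  have hbound : ∀ s ∈ Set.Ico 0 t,
      ‖⁅heisenberg H s HX, b⁆‖ ≤ N * C * c * Real.exp (4 * N * C * s) := by
    intro s hs
    have e : ⁅heisenberg H s HX, b⁆ =
        ∑ Z ∈ Λ.powerset with ¬ Disjoint Z X, ⁅heisenberg H s (h Z), b⁆ := by
      rw [hHX, heisenberg_sum, commutator_sum_left]
    calc ‖⁅heisenberg H s HX, b⁆‖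
        ≤ ∑ Z ∈ Λ.powerset with ¬ Disjoint Z X, ‖⁅heisenberg H s (h Z), b⁆‖ := by
          rw [e]; exact norm_sum_le _ _
      _ ≤ ∑ Z ∈ Λ.powerset with ¬ Disjoint Z X,
            K * ‖h Z‖ * ‖b‖ * Real.exp (4 * N * C * s) * weight F Y Z :=
          Finset.sum_le_sum fun Z hZ =>
            hP Z (Finset.mem_powerset.1 (Finset.mem_filter.1 hZ).1) _ (hh.isLocal Z) s hs.1
      _ = K * ‖b‖ * Real.exp (4 * N * C * s) *
            ∑ Z ∈ Λ.powerset with ¬ Disjoint Z X, ‖h Z‖ * weight F Y Z := by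
          rw [Finset.mul_sum]
          exact Finset.sum_congr rfl fun Z _ => by ring
      _ ≤ K * ‖b‖ * Real.exp (4 * N * C * s) * (N * C * weight F Y X) := by
          gcongr
          exact hh.sum_norm_mul_weight_le hC Λ X Y
      _ = N * C * c * Real.exp (4 * N * C * s) := by rw [hc]; ring
  have key := norm_commutator_heisenberg_le (hh.isSelfAdjoint_sum _) (hh.isSelfAdjoint_sum _)
    hcomm hΦ hbound t ⟨ht, le_rfl⟩
  have h0 := norm_commutator_le_weight hF ha hb
  have hexp : 1 ≤ Real.exp (4 * N * C * t) := by
    apply Real.one_le_exp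
    have : 0 ≤ 4 * (N * C) * t := by positivity
    linarith
  have hc0 : 0 ≤ c := by positivity
  calc _ ≤ ‖⁅a, b⁆‖ + 2 * ‖a‖ * (c / 4 * Real.exp (4 * N * C * t) -
        c / 4 * Real.exp (4 * N * C * 0)) := key
    _ ≤ 2 / F 0 * ‖a‖ * ‖b‖ * weight F Y X * Real.exp (4 * N * C * t) +
        2 * ‖a‖ * (c / 4 * Real.exp (4 * N * C * t)) := by
      refine add_le_add (h0.trans (le_mul_of_one_le_right (by positivity) hexp)) ?_
      gcongr
      have : 0 ≤ c / 4 * Real.exp (4 * N * C * 0) := by positivity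
      linarith
    _ = _ := by rw [hc]; ring

/-- In a fixed finite volume, the propagation estimate holds with some constant. -/
lemma exists_hasPropagationBound (hF : ∀ r, 0 < F r) (hh : IsFBounded F N h)
    (hC : HasConvolutionBound ν F C) (Λ : Finset (Site ν)) {Y : Finset (Site ν)}
    (hY : Y.Nonempty) {b : QuasiLocal ν k} (hb : QuasiLocal.incl ν k b ∈ localAlg ν k Y) :
    ∃ K, 0 ≤ K ∧ HasPropagationBound F N C h Λ Y b K := by
  have hnn : ∀ X ∈ Λ.powerset, 0 ≤ 2 / weight F Y X := fun X _ =>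
    div_nonneg zero_le_two (weight_nonneg F Y X)
  refine ⟨∑ X ∈ Λ.powerset, 2 / weight F Y X, Finset.sum_nonneg hnn, fun X hX a ha t ht => ?_⟩
  have hH : IsSelfAdjoint (localHamiltonian h Λ) := hh.isSelfAdjoint_sum _
  have hNC : 0 < N * C := mul_pos hh.pos hC.1
  obtain rfl | ⟨x, hx⟩ := X.eq_empty_or_nonempty
  · -- an observable with empty support is a scalar
    have h1 : Commute (localHamiltonian h Λ) a := Commute.sum_left _ _ _ fun Z _ =>
      commute_of_disjoint (Finset.disjoint_empty_right Z) (hh.isLocal Z) ha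
    rw [heisenberg_of_commute h1, Ring.lie_def,
      (commute_of_disjoint (Finset.disjoint_empty_left Y) ha hb).eq, sub_self, norm_zero]
    simp [weight]
  · obtain ⟨y, hy⟩ := hY
    have hw : 0 < weight F Y X := (NNReal.coe_pos.2 (hF _)).trans_le (le_weight F hx hy)
    have hK : 2 / weight F Y X ≤ ∑ X ∈ Λ.powerset, 2 / weight F Y X :=
      Finset.single_le_sum hnn (Finset.mem_powerset.2 hX)
    have hexp : 1 ≤ Real.exp (4 * N * C * t) := by
      apply Real.one_le_exp
      have : 0 ≤ 4 * (N * C) * t := by positivity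
      linarith
    have hK0 : 0 ≤ ∑ X ∈ Λ.powerset, 2 / weight F Y X := Finset.sum_nonneg hnn
    calc _ ≤ 2 * ‖a‖ * ‖b‖ := by
          simpa only [norm_heisenberg hH] using
            norm_commutator_le (heisenberg (localHamiltonian h Λ) t a) b
      _ = 2 / weight F Y X * ‖a‖ * ‖b‖ * 1 * weight F Y X := by field_simp
      _ ≤ _ := by gcongr

/-- **Lieb-Robinson bound**, with constants that do not depend on the volume `Λ`. -/
theorem hasPropagationBound (hF : ∀ r, 0 < F r) (hh : IsFBounded F N h)
    (hC : HasConvolutionBound ν F C) (Λ : Finset (Site ν)) {Y : Finset (Site ν)}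
    (hY : Y.Nonempty) {b : QuasiLocal ν k} (hb : QuasiLocal.incl ν k b ∈ localAlg ν k Y) :
    HasPropagationBound F N C h Λ Y b (4 / F 0) := by
  obtain ⟨K, hK, hP⟩ := exists_hasPropagationBound hF hh hC Λ hY hb
  have hF0 : (0 : ℝ) < F 0 := NNReal.coe_pos.2 (hF 0)
  -- `4 / F 0` is the fixed point of `K ↦ 2 / F 0 + K / 2`
  have hiter : ∀ n : ℕ, HasPropagationBound F N C h Λ Y b (4 / F 0 + K / 2 ^ n) := by
    intro n
    induction n with
    | zero =>
      intro X hX a ha t ht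
      refine (hP X hX a ha t ht).trans ?_
      have := weight_nonneg F Y X
      gcongr
      simpa using by positivity
    | succ n ih =>
      have := ih.step (hF 0) hh hC hb (by positivity)
      convert this using 1
      rw [pow_succ]
      ring
  intro X hX a ha t ht
  refine ge_of_tendsto' (f := fun n : ℕ => (4 / F 0 + K / 2 ^ n) * ‖a‖ * ‖b‖ *
    Real.exp (4 * N * C * t) * weight F Y X) (x := atTop) ?_ fun n => hiter n X hX a ha t ht
  have h1 : Tendsto (fun n : ℕ => (4 / F 0 + K / 2 ^ n : ℝ)) atTop (𝓝 (4 / F 0 + 0)) := by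
    refine tendsto_const_nhds.add ?_
    have := (tendsto_pow_atTop_nhds_zero_of_lt_one (r := (1 / 2 : ℝ)) (by norm_num)
      (by norm_num)).const_mul K
    simpa [div_eq_mul_inv] using this
  rw [add_zero] at h1
  exact (((h1.mul_const _).mul_const _).mul_const _).mul_const _

open Classical in
/-- Comparison of the dynamics of two volumes `Λ ⊆ Λ'` on an observable supported in `X`: the
error is controlled by the weight between `X` and `Λ' \ Λ`. -/
lemma norm_heisenberg_localHamiltonian_sub_le (hF : ∀ r, 0 < F r) (hh : IsFBounded F N h)
    (hC : HasConvolutionBound ν F C) {Λ Λ' X : Finset (Site ν)} (hΛ : Λ ⊆ Λ') (hX : X ⊆ Λ')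
    {a : QuasiLocal ν k} (ha : QuasiLocal.incl ν k a ∈ localAlg ν k X) {t : ℝ} (ht : 0 ≤ t) :
    ‖heisenberg (localHamiltonian h Λ') t a - heisenberg (localHamiltonian h Λ) t a‖ ≤
      4 / F 0 * ‖a‖ * Real.exp (4 * N * C * t) * (N * C) * t * weight F X (Λ' \ Λ) := by
  have hNC : 0 < N * C := mul_pos hh.pos hC.1
  have hdiff : localHamiltonian h Λ' - localHamiltonian h Λ =
      ∑ Z ∈ Λ'.powerset with ¬ Disjoint Z (Λ' \ Λ), h Z := by
    rw [localHamiltonian, localHamiltonian, sub_eq_iff_eq_add, ← Finset.sum_filter_not_add_sum_filter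
      (s := Λ'.powerset) (p := fun Z => Disjoint Z (Λ' \ Λ))]
    congr 1
    refine Finset.sum_congr ?_ fun _ _ => rfl
    ext Z
    simp only [Finset.mem_filter, Finset.mem_powerset]
    constructor
    · rintro ⟨h1, h2⟩ x hx
      by_contra hxΛ
      exact Finset.disjoint_left.1 h2 hx (Finset.mem_sdiff.2 ⟨h1 hx, hxΛ⟩)
    · intro h1
      exact ⟨h1.trans hΛ, Finset.disjoint_left.2 fun x hx hx' => (Finset.mem_sdiff.1 hx').2 (h1 hx)⟩
  have hbound : ∀ s ∈ Set.Ico 0 t, ‖⁅heisenberg (localHamiltonian h Λ') s a,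
      localHamiltonian h Λ' - localHamiltonian h Λ⁆‖ ≤
      4 / F 0 * ‖a‖ * Real.exp (4 * N * C * t) * (N * C * weight F X (Λ' \ Λ)) := by
    intro s hs
    have e : ⁅heisenberg (localHamiltonian h Λ') s a,
        localHamiltonian h Λ' - localHamiltonian h Λ⁆ =
        ∑ Z ∈ Λ'.powerset with ¬ Disjoint Z (Λ' \ Λ),
          ⁅heisenberg (localHamiltonian h Λ') s a, h Z⁆ := by
      rw [hdiff, commutator_sum_right]
    have hst : 4 * N * C * s ≤ 4 * N * C * t := by
      have := mul_le_mul_of_nonneg_left hs.2.le hNC.le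
      linarith
    calc _ ≤ ∑ Z ∈ Λ'.powerset with ¬ Disjoint Z (Λ' \ Λ),
          ‖⁅heisenberg (localHamiltonian h Λ') s a, h Z⁆‖ := by rw [e]; exact norm_sum_le _ _
      _ ≤ ∑ Z ∈ Λ'.powerset with ¬ Disjoint Z (Λ' \ Λ),
          4 / F 0 * ‖a‖ * Real.exp (4 * N * C * t) * (‖h Z‖ * weight F X Z) := by
          refine Finset.sum_le_sum fun Z hZ => ?_
          obtain ⟨z, hz, -⟩ := Finset.not_disjoint_iff.1 (Finset.mem_filter.1 hZ).2
          refine (hasPropagationBound hF hh hC Λ' ⟨z, hz⟩ (hh.isLocal Z) X hX a ha s hs.1).trans ?_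
          rw [weight_comm F Z X]
          have := weight_nonneg F X Z
          calc 4 / (F 0 : ℝ) * ‖a‖ * ‖h Z‖ * Real.exp (4 * N * C * s) * weight F X Z
              = 4 / (F 0 : ℝ) * ‖a‖ * Real.exp (4 * N * C * s) * (‖h Z‖ * weight F X Z) := by ring
            _ ≤ _ := by gcongr
      _ ≤ _ := by
          rw [← Finset.mul_sum]
          gcongr
          exact hh.sum_norm_mul_weight_le hC _ _ _
  refine (norm_heisenberg_sub_le (hh.isSelfAdjoint_sum _) ht hbound).trans (le_of_eq ?_)
  ring

end LiebRobinson

/-! ### Limits of inner dynamics -/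

section Limit

variable {A : Type*} [CStarAlgebra A] {ι : Type*} {l : Filter ι} {H : ι → A}

/-- Since the finite-volume dynamics are isometric, their convergence on a dense set of observables
implies their convergence everywhere. -/
lemma cauchy_heisenberg_of_dense [l.NeBot] (hH : ∀ i, IsSelfAdjoint (H i)) (t : ℝ) {D : Set A}
    (hD : Dense D) (hc : ∀ a ∈ D, Cauchy (l.map fun i => heisenberg (H i) t a)) (a : A) :
    Cauchy (l.map fun i => heisenberg (H i) t a) := by
  refine Metric.cauchy_iff.2 ⟨inferInstance, fun ε hε => ?_⟩
  obtain ⟨b, hb, hab⟩ := Metric.mem_closure_iff.1 (hD a) (ε / 3) (by positivity)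
  obtain ⟨s, hs, hs'⟩ := (Metric.cauchy_iff.1 (hc b hb)).2 (ε / 3) (by positivity)
  have hd : ∀ i, dist (heisenberg (H i) t a) (heisenberg (H i) t b) < ε / 3 := fun i => by
    rwa [dist_eq_norm, ← heisenberg_sub, norm_heisenberg (hH i), ← dist_eq_norm]
  refine ⟨(fun i => heisenberg (H i) t a) '' ((fun i => heisenberg (H i) t b) ⁻¹' s),
    image_mem_map hs, ?_⟩
  rintro _ ⟨i, hi, rfl⟩ _ ⟨j, hj, rfl⟩
  have h1 := hs' _ hi _ hj
  have h2 := hd i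
  have h3 := hd j
  rw [dist_comm] at h3
  linarith [dist_triangle4 (heisenberg (H i) t a) (heisenberg (H i) t b)
    (heisenberg (H j) t b) (heisenberg (H j) t a)]

/-- A pointwise limit of Heisenberg dynamics consists of automorphisms: the inverse of the limit at
time `t` is the limit at time `-t`. -/
lemma exists_starAlgEquiv_tendsto_heisenberg [l.NeBot] (hH : ∀ i, IsSelfAdjoint (H i))
    (hc : ∀ (t : ℝ) (a : A), Cauchy (l.map fun i => heisenberg (H i) t a)) :
    ∃ α : ℝ → A ≃⋆ₐ[ℂ] A, ∀ t a, Tendsto (fun i => heisenberg (H i) t a) l (𝓝 (α t a)) := by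
  choose f hf using fun t a => CompleteSpace.complete (hc t a)
  have hf : ∀ t a, Tendsto (fun i => heisenberg (H i) t a) l (𝓝 (f t a)) := hf
  have hinv : ∀ t a, f t (f (-t) a) = a := fun t a => by
    have h1 : Tendsto (fun i => heisenberg (H i) t (f (-t) a - heisenberg (H i) (-t) a)) l
        (𝓝 0) := by
      rw [tendsto_zero_iff_norm_tendsto_zero]
      simp only [norm_heisenberg (hH _)]
      rw [← tendsto_zero_iff_norm_tendsto_zero]
      simpa using (tendsto_const_nhds (x := f (-t) a)).sub (hf (-t) a)
    simp only [heisenberg_sub, heisenberg_heisenberg_neg] at h1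
    have h2 := h1.add_const a
    simp only [sub_add_cancel, zero_add] at h2
    exact tendsto_nhds_unique (hf t _) h2
  refine ⟨fun t =>
    { toFun := f t
      invFun := f (-t)
      left_inv := fun a => by simpa using hinv (-t) a
      right_inv := hinv t
      map_mul' := fun a b => tendsto_nhds_unique (hf t _)
        (((hf t a).mul (hf t b)).congr fun i => (heisenberg_mul _ _ _ _).symm)
      map_add' := fun a b => tendsto_nhds_unique (hf t _)
        (((hf t a).add (hf t b)).congr fun i => (heisenberg_add _ _ _ _).symm)
      map_star' := fun a => tendsto_nhds_unique (hf t _)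
        ((hf t a).star.congr fun i => (heisenberg_star (hH i) _ _).symm)
      map_smul' := fun c a => tendsto_nhds_unique (hf t _)
        (((hf t a).const_smul c).congr fun i => (heisenberg_smul _ _ _ _).symm) }, hf⟩

end Limit

/-! ### The thermodynamic limit -/

section Thermodynamic

variable {ν k : ℕ} {F : ℝ≥0 → ℝ≥0} {N C : ℝ} {h : Finset (Site ν) → QuasiLocal ν k}

lemma localDynamics_eq_heisenberg (h : Finset (Site ν) → QuasiLocal ν k) (Λ : Finset (Site ν))
    (t : ℝ) (a : QuasiLocal ν k) :
    localDynamics h Λ t a = heisenberg (localHamiltonian h Λ) t a := by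
  have hp : ∀ s : ℝ, propagator h Λ s = expGroup (localHamiltonian h Λ) (-s) := fun s => by
    rw [propagator, expGroup, ← Complex.coe_smul, smul_smul]
    congr 2
    push_cast
    ring
  rw [localDynamics, hp, hp, neg_neg, heisenberg]

lemma dense_setOf_local (ν k : ℕ) :
    Dense {a : QuasiLocal ν k | ∃ X, QuasiLocal.incl ν k a ∈ localAlg ν k X} := by
  intro a
  refine Metric.mem_closure_iff.2 fun ε hε => ?_
  obtain ⟨b, hb, hab⟩ := Metric.mem_closure_iff.1 (show a.1 ∈ closure (locAlg ν k : Set _) from a.2)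
    ε hε
  exact ⟨⟨b, subset_closure hb⟩, mem_locAlg.1 hb, hab⟩

lemma SpinSystem.IsFFunction.summable_real (hF : IsFFunction ν F) (x : Site ν) :
    Summable fun y : Site ν => (F (nndist y x) : ℝ) := by
  have h1 : ∑' y : Site ν, (F (nndist x y) : ℝ≥0∞) ≠ ∞ :=
    ((le_iSup (fun x : Site ν => ∑' y : Site ν, (F (nndist x y) : ℝ≥0∞)) x).trans_lt
      hF.summable).ne
  simpa only [nndist_comm x] using NNReal.summable_coe.2 (ENNReal.tsum_coe_ne_top_iff_summable.1 h1)

lemma SpinSystem.IsFFunction.exists_hasConvolutionBound (hF : IsFFunction ν F) :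
    ∃ C, HasConvolutionBound ν F C := by
  obtain ⟨C, hC, h⟩ := hF.convolution
  refine ⟨C, NNReal.coe_pos.2 hC, fun x y S => ?_⟩
  have h1 := (ENNReal.sum_le_tsum S).trans (h x y)
  exact_mod_cast h1

/-- The bound `N` is the `F`-norm plus one, so that it is positive also for the zero interaction. -/
lemma isFBounded_of_FNorm_lt_top (hF : IsFFunction ν F) (hsa : ∀ Z, IsSelfAdjoint (h Z))
    (hloc : ∀ Z, QuasiLocal.incl ν k (h Z) ∈ localAlg ν k Z) (hfin : FNorm F h < ∞) :
    IsFBounded F ((FNorm F h).toReal + 1) h where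
  selfAdjoint := hsa
  isLocal := hloc
  pos := by positivity
  sum_le x y S hS := by
    have h1 : (∑ Z ∈ S, ‖h Z‖ₑ) * (F (nndist x y) : ℝ≥0∞)⁻¹ ≤ FNorm F h := by
      rw [Finset.sum_mul, ← Finset.sum_subtype_of_mem _ hS]
      exact (ENNReal.sum_le_tsum _).trans (le_iSup₂ (f := fun x y : Site ν =>
        ∑' Z : {Z : Finset (Site ν) // x ∈ Z ∧ y ∈ Z}, ‖h Z‖ₑ * (F (nndist x y) : ℝ≥0∞)⁻¹) x y)
    have hF0 : (F (nndist x y) : ℝ≥0∞) ≠ 0 := by simpa using (hF.pos _).ne'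
    rw [← div_eq_mul_inv, ENNReal.div_le_iff hF0 ENNReal.coe_ne_top] at h1
    have h2 := ENNReal.toReal_mono (ENNReal.mul_ne_top hfin.ne ENNReal.coe_ne_top) h1
    rw [ENNReal.toReal_sum (fun _ _ => enorm_ne_top), ENNReal.toReal_mul] at h2
    simp only [toReal_enorm, ENNReal.coe_toReal] at h2
    refine h2.trans ?_
    gcongr
    simp

/-- For a local observable and nonnegative times, the finite-volume dynamics form a Cauchy net: the
comparison error is a constant times a piece of the tail of `∑_v ∑_{x ∈ X} F(d(v, x))`. -/
lemma cauchySeq_heisenberg_of_nonneg (hF : IsFFunction ν F) (hh : IsFBounded F N h)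
    {X : Finset (Site ν)} {a : QuasiLocal ν k} (ha : QuasiLocal.incl ν k a ∈ localAlg ν k X)
    {t : ℝ} (ht : 0 ≤ t) :
    CauchySeq fun Λ : Finset (Site ν) => heisenberg (localHamiltonian h Λ) t a := by
  classical
  obtain ⟨C, hC⟩ := hF.exists_hasConvolutionBound
  set c : ℝ := 4 / F 0 * ‖a‖ * Real.exp (4 * N * C * t) * (N * C) * t with hc
  have hc0 : 0 ≤ c := by
    have := hh.pos
    have := hC.1
    positivity
  have hs : Summable fun v : Site ν => ∑ x ∈ X, (F (nndist v x) : ℝ) :=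
    summable_sum fun x _ => hF.summable_real x
  refine Metric.cauchySeq_iff'.2 fun ε hε => ?_
  obtain ⟨S, hS⟩ := summable_iff_vanishing_norm.1 hs (ε / (c + 1)) (by positivity)
  refine ⟨S ∪ X, fun Λ hΛ => ?_⟩
  have hΛ' : S ∪ X ⊆ Λ := hΛ
  have h1 : weight F X (Λ \ (S ∪ X)) < ε / (c + 1) :=
    (le_abs_self _).trans_lt (hS _ (Finset.disjoint_of_subset_right Finset.subset_union_left
      Finset.sdiff_disjoint))
  rw [dist_eq_norm]
  refine (norm_heisenberg_localHamiltonian_sub_le hF.pos hh hC hΛ'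
    (Finset.subset_union_right.trans hΛ') ha ht).trans_lt ?_
  rw [← hc]
  have hw := weight_nonneg F X (Λ \ (S ∪ X))
  calc c * weight F X (Λ \ (S ∪ X)) ≤ (c + 1) * weight F X (Λ \ (S ∪ X)) := by
        gcongr; linarith
    _ < (c + 1) * (ε / (c + 1)) := by gcongr
    _ = ε := by field_simp

lemma cauchySeq_heisenberg (hF : IsFFunction ν F) (hh : IsFBounded F N h) (t : ℝ)
    (a : QuasiLocal ν k) :
    CauchySeq fun Λ : Finset (Site ν) => heisenberg (localHamiltonian h Λ) t a := by
  classical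
  refine cauchy_heisenberg_of_dense (fun Λ => hh.isSelfAdjoint_sum _) t (dense_setOf_local ν k) ?_ a
  rintro b ⟨X, hb⟩
  rcases le_total 0 t with ht | ht
  · exact cauchySeq_heisenberg_of_nonneg hF hh hb ht
  · -- reversing time amounts to changing the sign of the interaction
    have h1 := cauchySeq_heisenberg_of_nonneg hF hh.neg hb (neg_nonneg.2 ht)
    simpa only [localHamiltonian_neg, heisenberg_neg_left, neg_neg] using! h1

lemma SpinSystem.IsIAS.tendsto_atTop {Λ : ℕ → Finset (Site ν)} (hΛ : IsIAS Λ) :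
    Tendsto Λ atTop atTop :=
  tendsto_atTop_finset_of_monotone (monotone_nat_of_le_succ hΛ.mono) hΛ.absorbing

/-- The thermodynamic limit exists for every self-adjoint local interaction of finite `F`-norm. -/
theorem exists_isThermodynamicLimit (hF : IsFFunction ν F) (hsa : ∀ Z, IsSelfAdjoint (h Z))
    (hloc : ∀ Z, QuasiLocal.incl ν k (h Z) ∈ localAlg ν k Z) (hfin : FNorm F h < ∞) :
    ∃ α : ℝ → QuasiLocal ν k ≃⋆ₐ[ℂ] QuasiLocal ν k, IsThermodynamicLimit h α := by
  classical
  have hh := isFBounded_of_FNorm_lt_top hF hsa hloc hfin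
  obtain ⟨α, hα⟩ := exists_starAlgEquiv_tendsto_heisenberg
    (fun Λ => hh.isSelfAdjoint_sum (Finset.powerset Λ)) (cauchySeq_heisenberg hF hh)
  refine ⟨α, fun Λ hΛ t a => ?_⟩
  simp only [localDynamics_eq_heisenberg]
  exact (hα t a).comp hΛ.tendsto_atTop

end Thermodynamic

/-! ### Weak and strong measurability -/

section Pettis

variable {Ω : Type*} [MeasurableSpace Ω]

/-- In a separable normed space, countably many functionals of norm at most one determine the
norm. -/
lemma exists_norming_sequence (E : Type*) [NormedAddCommGroup E] [NormedSpace ℂ E]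
    [TopologicalSpace.SeparableSpace E] :
    ∃ φ : ℕ → StrongDual ℂ E, ∀ (x : E) (r : ℝ), ‖x‖ ≤ r ↔ ∀ n, ‖φ n x‖ ≤ r := by
  choose g hg hgx using fun x : E => exists_dual_vector'' ℂ x
  refine ⟨fun n => g (TopologicalSpace.denseSeq E n), fun x r => ⟨fun h n => ?_, fun h => ?_⟩⟩
  · exact ((g _).le_of_opNorm_le (hg _) x).trans (by simpa using h)
  · refine le_of_forall_pos_le_add fun ε hε => ?_
    obtain ⟨n, hn⟩ := (TopologicalSpace.denseRange_denseSeq E).exists_dist_lt x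
      (show 0 < ε / 2 by positivity)
    set y := TopologicalSpace.denseSeq E n with hy
    rw [dist_eq_norm] at hn
    have h1 : ‖y‖ ≤ r + ‖x - y‖ := by
      have e : (‖y‖ : ℂ) = g y x - g y (x - y) := by
        rw [← map_sub, sub_sub_cancel]; exact (hgx y).symm
      have h2 := (g y).le_of_opNorm_le (hg y) (x - y)
      calc ‖y‖ = ‖(‖y‖ : ℂ)‖ := by simp
        _ ≤ ‖g y x‖ + ‖g y (x - y)‖ := by rw [e]; exact norm_sub_le _ _
        _ ≤ r + ‖x - y‖ := add_le_add (h n) (by simpa using h2)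
    have h3 : ‖x‖ ≤ ‖y‖ + ‖x - y‖ := by
      simpa using norm_add_le y (x - y)
    linarith

/-- **Pettis' theorem** for separable spaces: weak measurability implies strong measurability. -/
theorem stronglyMeasurable_of_forall_dual {E : Type*} [NormedAddCommGroup E] [NormedSpace ℂ E]
    [TopologicalSpace.SeparableSpace E] {f : Ω → E}
    (hf : ∀ φ : StrongDual ℂ E, Measurable fun ω => φ (f ω)) : StronglyMeasurable f := by
  obtain ⟨φ, hφ⟩ := exists_norming_sequence E
  have hball : ∀ (c : E) (r : ℝ), MeasurableSet (f ⁻¹' Metric.closedBall c r) := fun c r => by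
    have e : f ⁻¹' Metric.closedBall c r = ⋂ n, {ω | ‖φ n (f ω) - φ n c‖ ≤ r} := by
      ext ω
      simp only [Set.mem_preimage, mem_closedBall_iff_norm, hφ, map_sub, Set.mem_iInter,
        Set.mem_ofPred_eq]
    rw [e]
    exact MeasurableSet.iInter fun n =>
      measurableSet_le ((hf (φ n)).sub_const _).norm measurable_const
  let _ : MeasurableSpace E := borel E
  have _ : BorelSpace E := ⟨rfl⟩
  have _ := UniformSpace.secondCountable_of_separable E
  refine Measurable.stronglyMeasurable (measurable_of_isOpen fun U hU => ?_)
  have hU' : ∀ x ∈ U, ∃ r : ℝ, 0 < r ∧ Metric.closedBall x r ⊆ U := fun x hx =>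
    Metric.nhds_basis_closedBall.mem_iff.1 (hU.mem_nhds hx)
  choose! ρ hρ hρU using hU'
  obtain ⟨T, hT, hTU⟩ := TopologicalSpace.isOpen_iUnion_countable (α := E)
    (fun x : U => Metric.ball (x : E) (ρ x)) fun _ => Metric.isOpen_ball
  have e : U = ⋃ x ∈ T, Metric.closedBall (x : E) (ρ x) := by
    refine Set.Subset.antisymm (fun x hx => ?_) (Set.iUnion₂_subset fun x _ => hρU x x.2)
    have : x ∈ ⋃ x : U, Metric.ball (x : E) (ρ x) :=
      Set.mem_iUnion.2 ⟨⟨x, hx⟩, Metric.mem_ball_self (hρ x hx)⟩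
    rw [← hTU] at this
    exact Set.iUnion₂_mono (fun _ _ => Metric.ball_subset_closedBall) this
  rw [e, Set.preimage_iUnion₂]
  exact MeasurableSet.biUnion hT fun x _ => hball _ _

lemma continuous_heisenberg {A : Type*} [CStarAlgebra A] (t : ℝ) (a : A) :
    Continuous fun H : A => heisenberg H t a := by
  let _ : NormedAlgebra ℚ A := .restrictScalars ℚ ℂ A
  have hc : ∀ s : ℝ, Continuous fun H : A => expGroup H s := fun s =>
    NormedSpace.exp_continuous.comp (by fun_prop)
  exact ((hc t).mul continuous_const).mul (hc (-t))

end Pettis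

section Measurability

variable {Ω : Type*} [MeasurableSpace Ω] {ν k : ℕ}

instance (ν k : ℕ) : TopologicalSpace.SeparableSpace (QuasiLocal ν k) := by
  have hloc : ∀ Λ, TopologicalSpace.IsSeparable
      (localAlg ν k Λ : Set (ConfigSpace ν k →L[ℂ] ConfigSpace ν k)) := fun Λ => by
    have e : (localAlg ν k Λ : Set (ConfigSpace ν k →L[ℂ] ConfigSpace ν k)) =
        Set.range (localEmbed ν k Λ) := Set.ext fun _ => Iff.rfl
    rw [e]
    have _ : TopologicalSpace.SeparableSpace (Matrix (LocalConfig k Λ) (LocalConfig k Λ) ℂ) :=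
      inferInstanceAs (TopologicalSpace.SeparableSpace (LocalConfig k Λ → LocalConfig k Λ → ℂ))
    exact TopologicalSpace.isSeparable_range
      (LinearMap.continuous_of_finiteDimensional (localEmbed ν k Λ).toAlgHom.toLinearMap)
  have h : TopologicalSpace.IsSeparable
      (quasiLocalAlg ν k : Set (ConfigSpace ν k →L[ℂ] ConfigSpace ν k)) := by
    change TopologicalSpace.IsSeparable 
      (closure (locAlg ν k : Set (ConfigSpace ν k →L[ℂ] ConfigSpace ν k)))
    rw [TopologicalSpace.isSeparable_closure, coe_locAlg]
    exact TopologicalSpace.isSeparable_iUnion.2 hloc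
  exact h.separableSpace

variable {P : Measure Ω} {h : Ω → Finset (Site ν) → QuasiLocal ν k}

lemma SpinSystem.IsDisorderedInteraction.stronglyMeasurable (hh : IsDisorderedInteraction P h)
    (Z : Finset (Site ν)) : StronglyMeasurable fun ω => h ω Z :=
  stronglyMeasurable_of_forall_dual (hh.weakly_measurable Z)

lemma SpinSystem.IsDisorderedInteraction.measurable_FNorm (hh : IsDisorderedInteraction P h)
    (F : ℝ≥0 → ℝ≥0) : Measurable fun ω => FNorm F (h ω) := by
  have _ : ∀ x y : Site ν, Countable {Z : Finset (Site ν) // x ∈ Z ∧ y ∈ Z} := fun _ _ =>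
    Subtype.countable
  refine Measurable.iSup fun x => Measurable.iSup fun y => Measurable.tsum fun Z => ?_
  exact ((hh.stronglyMeasurable Z).enorm).mul_const _

lemma SpinSystem.IsDisorderedInteraction.measurable_dual_localDynamics
    (hh : IsDisorderedInteraction P h)
    (Λ : Finset (Site ν)) (t : ℝ) (a : QuasiLocal ν k) (φ : StrongDual ℂ (QuasiLocal ν k)) :
    Measurable fun ω => φ (localDynamics (h ω) Λ t a) := by
  simp only [localDynamics_eq_heisenberg]
  have h1 : StronglyMeasurable fun ω => localHamiltonian (h ω) Λ :=
    Finset.stronglyMeasurable_fun_sum Λ.powerset fun Z _ => hh.stronglyMeasurable Z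
  exact ((φ.continuous.comp (continuous_heisenberg t a)).comp_stronglyMeasurable h1).measurable

end Measurability

/-! ### Covariance under lattice translations -/

section Covariance

variable {ν k : ℕ} {h h' : Finset (Site ν) → QuasiLocal ν k} {x : Site ν}

lemma tau_neg_tau (x : Site ν) (a : QuasiLocal ν k) : tau (-x) (tau x a) = a :=
  (tau x).symm_apply_apply a

lemma isometry_tau (x : Site ν) : Isometry (tau (k := k) x) :=
  StarAlgEquiv.isometry _

lemma shiftVolume_injective (x : Site ν) : Function.Injective (shiftVolume x) :=
  Finset.map_injective _

lemma mem_shiftVolume {y : Site ν} {Λ : Finset (Site ν)} :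
    y + x ∈ shiftVolume x Λ ↔ y ∈ Λ := by
  simp [shiftVolume]

lemma FNorm_eq_of_covariant (F : ℝ≥0 → ℝ≥0)
    (hcov : ∀ Z, tau x (h Z) = h' (shiftVolume x Z)) : FNorm F h' = FNorm F h := by
  symm
  refine (Equiv.addRight x).iSup_congr fun u =>
    ((Equiv.addRight x).iSup_congr fun v => ?_).symm
  simp only [Equiv.coe_addRight]
  have e := ((Equiv.addRight x).finsetCongr.subtypeEquiv
    (p := fun Z : Finset (Site ν) => u ∈ Z ∧ v ∈ Z)
    (q := fun Z : Finset (Site ν) => u + x ∈ Z ∧ v + x ∈ Z) fun Z => by simp).tsum_eq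
    fun Z => ‖h' Z‖ₑ * (F (nndist (u + x) (v + x)) : ℝ≥0∞)⁻¹
  rw [← e]
  refine tsum_congr fun Z => ?_
  have h1 : h' (((Equiv.addRight x).finsetCongr.subtypeEquiv
    (p := fun Z : Finset (Site ν) => u ∈ Z ∧ v ∈ Z)
    (q := fun Z : Finset (Site ν) => u + x ∈ Z ∧ v + x ∈ Z) (fun Z => by simp)) Z) =
      tau x (h Z) := (hcov Z).symm
  rw [h1, nndist_add_right]
  congr 1
  exact enorm_eq_iff_norm_eq.2 ((isometry_tau x).norm_map_of_map_zero (map_zero _) _)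

lemma tau_localHamiltonian (hcov : ∀ Z, tau x (h Z) = h' (shiftVolume x Z))
    (Λ : Finset (Site ν)) :
    tau x (localHamiltonian h Λ) = localHamiltonian h' (shiftVolume x Λ) := by
  rw [localHamiltonian, map_sum, localHamiltonian]
  refine Finset.sum_bij (fun Z _ => shiftVolume x Z) (fun Z hZ => ?_)
    (fun _ _ _ _ hZ => shiftVolume_injective x hZ) (fun Z hZ => ?_) fun Z _ => hcov Z
  · exact Finset.mem_powerset.2 (Finset.map_subset_map.2 (Finset.mem_powerset.1 hZ))
  · obtain ⟨W, hW, rfl⟩ := Finset.subset_map_iff.1 (Finset.mem_powerset.1 hZ)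
    exact ⟨W, Finset.mem_powerset.2 hW, rfl⟩

lemma map_heisenberg {A B : Type*} [CStarAlgebra A] [CStarAlgebra B] (τ : A ≃⋆ₐ[ℂ] B) (H : A)
    (t : ℝ) (a : A) : τ (heisenberg H t a) = heisenberg (τ H) t (τ a) := by
  have he : ∀ s, τ (expGroup H s) = expGroup (τ H) s := fun s => by
    let _ : NormedAlgebra ℚ A := .restrictScalars ℚ ℂ A
    let _ : NormedAlgebra ℚ B := .restrictScalars ℚ ℂ B
    rw [expGroup, NormedSpace.map_exp τ (StarAlgEquiv.isometry τ).continuous, expGroup,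
      ← Complex.coe_smul, map_smul, map_smul, Complex.coe_smul]
  rw [heisenberg, map_mul, map_mul, he, he, heisenberg]

lemma tau_localDynamics (hcov : ∀ Z, tau x (h Z) = h' (shiftVolume x Z)) (Λ : Finset (Site ν))
    (t : ℝ) (a : QuasiLocal ν k) :
    tau x (localDynamics h Λ t a) = localDynamics h' (shiftVolume x Λ) t (tau x a) := by
  rw [localDynamics_eq_heisenberg, localDynamics_eq_heisenberg, map_heisenberg,
    tau_localHamiltonian hcov]

lemma SpinSystem.IsIAS.shiftVolume {Λ : ℕ → Finset (Site ν)} (hΛ : IsIAS Λ) (x : Site ν) :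
    IsIAS fun n => shiftVolume x (Λ n) where
  mono n := Finset.map_subset_map.2 (hΛ.mono n)
  absorbing y := by
    obtain ⟨n, hn⟩ := hΛ.absorbing (y - x)
    exact ⟨n, by simpa using (mem_shiftVolume (x := x)).2 hn⟩

lemma exists_isIAS (ν : ℕ) : ∃ Λ : ℕ → Finset (Site ν), IsIAS Λ := by
  refine ⟨fun n => Finset.Icc (fun _ => -(n : ℤ)) fun _ => (n : ℤ), fun n => ?_, fun x => ?_⟩
  · refine Finset.Icc_subset_Icc (fun _ => ?_) fun _ => ?_ <;> push_cast <;> linarith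
  · refine ⟨∑ i, (x i).natAbs, Finset.mem_Icc.2 ?_⟩
    have hx : ∀ i, |x i| ≤ ((∑ i, (x i).natAbs : ℕ) : ℤ) := fun i => by
      rw [Int.abs_eq_natAbs]
      exact_mod_cast Finset.single_le_sum (f := fun i => (x i).natAbs) (fun _ _ => Nat.zero_le _)
        (Finset.mem_univ i)
    exact ⟨fun i => (abs_le.1 (hx i)).1, fun i => (abs_le.1 (hx i)).2⟩

/-- The thermodynamic limits of an interaction and of its translate are conjugate, because the
translates of an exhausting sequence of volumes are again exhausting. -/
lemma SpinSystem.IsThermodynamicLimit.covariant {α α' : ℝ → QuasiLocal ν k ≃⋆ₐ[ℂ] QuasiLocal ν k}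
    (hα : IsThermodynamicLimit h α) (hα' : IsThermodynamicLimit h' α')
    (hcov : ∀ Z, tau x (h Z) = h' (shiftVolume x Z)) (t : ℝ) (a : QuasiLocal ν k) :
    α t a = tau (-x) (α' t (tau x a)) := by
  obtain ⟨Λ, hΛ⟩ := exists_isIAS ν
  have h1 := ((isometry_tau x).continuous.tendsto _).comp (hα Λ hΛ t a)
  have h2 := hα' _ (hΛ.shiftVolume x) t (tau x a)
  rw [← tendsto_nhds_unique h1 (h2.congr fun n => (tau_localDynamics hcov (Λ n) t a).symm),
    tau_neg_tau]

end Covariance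

/-! ### Ergodic interactions -/

section Ergodic

variable {Ω : Type*} [MeasurableSpace Ω] {P : Measure Ω}

/-- An almost surely invariant function of an ergodic group action is almost surely constant. -/
lemma ae_eq_const_of_ergodicVAdd {G : Type*} [VAdd G Ω] [ErgodicVAdd G Ω P] {f : Ω → ℝ≥0∞}
    (hf : Measurable f) (hinv : ∀ g : G, ∀ᵐ ω ∂P, f (g +ᵥ ω) = f ω) :
    ∃ c, ∀ᵐ ω ∂P, f ω = c := by
  refine exists_eventuallyEq_const_of_forall_separating MeasurableSet fun U hU => ?_
  have h1 : EventuallyConst (f ⁻¹' U) (ae P) :=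
    ErgodicVAdd.aeconst_of_forall_preimage_vadd_ae_eq (G := G) (hf hU) fun g => by
      filter_upwards [hinv g] with ω hω
      exact congrArg (· ∈ U) hω
  exact eventuallyConst_set.1 h1

variable {ν k : ℕ}

/-- A family of thermodynamic limits that exist on a measurable set `G` is weakly measurable once
it is extended trivially off `G`. -/
lemma SpinSystem.IsDisorderedInteraction.measurable_dual_limit
    {h : Ω → Finset (Site ν) → QuasiLocal ν k} (hh : IsDisorderedInteraction P h) {G : Set Ω} (hG : MeasurableSet G)
    {α : Ω → ℝ → QuasiLocal ν k ≃⋆ₐ[ℂ] QuasiLocal ν k}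
    (hα : ∀ ω ∈ G, IsThermodynamicLimit (h ω) (α ω))
    (hα' : ∀ ω ∉ G, ∀ t a, α ω t a = a) (t : ℝ) (a : QuasiLocal ν k)
    (φ : StrongDual ℂ (QuasiLocal ν k)) : Measurable fun ω => φ (α ω t a) := by
  classical
  obtain ⟨Λ, hΛ⟩ := exists_isIAS ν
  refine measurable_of_tendsto_metrizable
    (f := fun n ω => if ω ∈ G then φ (localDynamics (h ω) (Λ n) t a) else φ a)
    (fun n => Measurable.ite hG (hh.measurable_dual_localDynamics _ _ _ _) measurable_const)
    (tendsto_pi_nhds.2 fun ω => ?_)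
  by_cases hω : ω ∈ G
  · simpa only [if_pos hω] using! (φ.continuous.tendsto _).comp (hα ω hω Λ hΛ t a)
  · simp only [if_neg hω, hα' ω hω, tendsto_const_nhds]

variable [AddAction (Site ν) Ω] {h : Ω → Finset (Site ν) → QuasiLocal ν k}

lemma SpinSystem.IsErgodicInteraction.ae_covariant (hh : IsErgodicInteraction P h) :
    ∀ᵐ ω ∂P, ∀ x Z, tau x (h ω Z) = h (x +ᵥ ω) (shiftVolume x Z) :=
  ae_all_iff.2 fun x => ae_all_iff.2 fun Z => hh.covariant x Z

lemma SpinSystem.IsErgodicInteraction.ae_vadd (hh : IsErgodicInteraction P h) {p : Ω → Prop}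
    (hp : ∀ᵐ ω ∂P, p ω) : ∀ᵐ ω ∂P, ∀ x : Site ν, p (x +ᵥ ω) := by
  have _ := hh.ergodic_action
  have _ : MeasurableConstVAdd (Site ν) Ω := ⟨hh.measurable_action⟩
  exact ae_all_iff.2 fun x => (measurePreserving_vadd x P).quasiMeasurePreserving.ae hp

/-- The `F`-norm is almost surely constant, as a measurable invariant function. -/
lemma SpinSystem.IsErgodicInteraction.exists_ae_FNorm_eq (hh : IsErgodicInteraction P h)
    (F : ℝ≥0 → ℝ≥0) (hfin : 0 < P {ω | FNorm F (h ω) < ∞}) :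
    ∃ c : ℝ≥0, ∀ᵐ ω ∂P, FNorm F (h ω) = c := by
  have _ := hh.ergodic_action
  obtain ⟨c, hc⟩ := ae_eq_const_of_ergodicVAdd (P := P) (G := Site ν)
    (hh.toIsDisorderedInteraction.measurable_FNorm F) fun x =>
      hh.ae_covariant.mono fun ω hω => FNorm_eq_of_covariant F (hω x)
  have hc' : c ≠ ∞ := by
    rintro rfl
    refine hfin.ne' (measure_mono_null (fun ω hω => ?_) (ae_iff.1 hc))
    exact (show FNorm F (h ω) < ∞ from hω).ne
  exact ⟨c.toNNReal, hc.mono fun ω hω => by rw [hω, ENNReal.coe_toNNReal hc']⟩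

end Ergodic

theorem mainTheorem5 {Ω : Type*} [MeasurableSpace Ω] (P : Measure Ω) [IsProbabilityMeasure P]
    (ν k : ℕ) [NeZero k] [AddAction (Site ν) Ω]
    (F : ℝ≥0 → ℝ≥0) (hF : IsFFunction ν F)
    (h : Ω → Finset (Site ν) → QuasiLocal ν k) (hh : IsErgodicInteraction P h)
    (hfin : 0 < P {ω | FNorm F (h ω) < ∞}) :
    (∃ c : ℝ≥0, ∀ᵐ ω ∂P, FNorm F (h ω) = c) ∧
    ∃ α : Ω → ℝ → QuasiLocal ν k ≃⋆ₐ[ℂ] QuasiLocal ν k,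
      (∀ (t : ℝ) (a : QuasiLocal ν k) (φ : StrongDual ℂ (QuasiLocal ν k)),
        Measurable fun ω => φ (α ω t a)) ∧
      ∀ᵐ ω ∂P, IsThermodynamicLimit (h ω) (α ω) ∧
        ∀ (x : Site ν) (t : ℝ) (a : QuasiLocal ν k),
          α ω t a = tau (-x) (α (x +ᵥ ω) t (tau x a)) := by
  classical
  obtain ⟨c, hc⟩ := hh.exists_ae_FNorm_eq F hfin
  refine ⟨⟨c, hc⟩, ?_⟩
  have hlim : ∀ᵐ ω ∂P, ∃ α, IsThermodynamicLimit (h ω) α := by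
    filter_upwards [hc, ae_all_iff.2 hh.local_selfAdjoint] with ω hω hloc
    exact exists_isThermodynamicLimit hF (fun Z => (hloc Z).1) (fun Z => (hloc Z).2)
      (hω ▸ ENNReal.coe_lt_top)
  -- the exceptional set is enlarged to a measurable one, on which the dynamics is set to be trivial
  obtain ⟨G, hGae, hG, hGlim⟩ := hlim.exists_measurable_mem
  set α : Ω → ℝ → QuasiLocal ν k ≃⋆ₐ[ℂ] QuasiLocal ν k := fun ω =>
    if hω : ω ∈ G then (hGlim ω hω).choose else fun _ => StarAlgEquiv.refl ℂ _ with hα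
  have hα1 : ∀ ω ∈ G, IsThermodynamicLimit (h ω) (α ω) := fun ω hω => by
    simp only [hα, dif_pos hω]
    exact (hGlim ω hω).choose_spec
  have hα2 : ∀ ω ∉ G, ∀ t a, α ω t a = a := fun ω hω t a => by
    simp only [hα, dif_neg hω, StarAlgEquiv.coe_refl, id]
  refine ⟨α, hh.toIsDisorderedInteraction.measurable_dual_limit hG hα1 hα2, ?_⟩
  filter_upwards [hGae, hh.ae_vadd hGae, hh.ae_covariant] with ω hω hxω hcov
  exact ⟨hα1 ω hω, fun x t a =>
    (hα1 ω hω).covariant (hα1 _ (hxω x)) (hcov x) t a⟩
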